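/- Let $a=(a_k)_{k\ge 1}$ be a sequence of complex numbers with $a_1=0$, and put $(x\mid a)^m=\prod_{k=1}^m(x-a_k)$. Let $\Gamma$ be the algebra of supersymmetric functions: sequences $(f_n)$ of polynomials $f_n\in\mathbb C[x_1,\dots,x_n]$ of bounded degree with $f_{n+1}(x_1,\dots,x_n,0)=f_n(x_1,\dots,x_n)$, such that each $f_n$ is symmetric and the result of substituting $x_i=t$, $x_j=-t$ in $f_n$ does not depend on $t$ (for all $i<j$). For a strict partition $\lambda=(\lambda_1>\dots>\lambda_\ell>0)$ of length $\ell=\ell(\lambda)$ (with $\lambda_{\ell+1}=0$), let $P_{\lambda;a}\in\Gamma$ be the multiparameter Schur P-function, that is, the sequence of the polynomials $$ P_{\lambda;a|n}(x_1,\dots,x_n)=\frac1{(n-\ell)!}\sum_{\omega\in S(n)}\ \prod_{i=1}^{\ell}(x_{\omega(i)}\mid a)^{\lambda_i}\prod_{i\le \ell,\ i<j\le n}\frac{x_{\omega(i)}+x_{\omega(j)}}{x_{\omega(i)}-x_{\omega(j)}}\quad(\ell\le n),\qquad P_{\lambda;a|n}=0\quad(\ell>n), $$ and let $Q_{\lambda;a}=2^{\ell(\lambda)}P_{\lambda;a}$.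 For integers $k>l\ge 0$ let $Q_{(k,l);a}$ be the Q-function of the strict partition $(k,l)$ (which is $(k)$ if $l=0$), and for $0\le k\le l$ put $Q_{(k,l);a}=-Q_{(l,k);a}$ (so $Q_{(k,k);a}=0$). For a skew-symmetric $2m\times 2m$ matrix $A=(a_{ij})$ let $\operatorname{Pf}(A)=\sum_\omega \operatorname{sgn}(\omega)\prod_{i=1}^m a_{\omega(2i-1)\,\omega(2i)}$, summed over the $\omega\in S(2m)$ with $\omega(2i-1)<\omega(2i)$ for all $i$ and $\omega(1)<\omega(3)<\dots<\omega(2m-1)$. Theorem. For every strict partition $\lambda$ (including the empty one) the following identity holds in $\Gamma$: $$ Q_{\lambda;a}=\operatorname{Pf}\Bigl(\bigl(Q_{(\lambda_i,\lambda_j);a}\bigr)_{1\le i,j\le 2\left[\frac{\ell(\lambda)+1}{2}\right]}\Bigr), $$ where $[x]$ is the integral part of $x$. -/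

import Mathlib

namespace SchurQ

open MvPolynomial

/-! ### Pfaffians -/

/-- The Pfaffian of a skew-symmetric matrix of size `2m`: the sum of
`sgn ω * ∏ A (ω (2i-1)) (ω (2i))` over the permutations `ω` with `ω (2i-1) < ω (2i)` for all `i`
and `ω 1 < ω 3 < ... < ω (2m-1)` (positions are numbered from `0` in the code). -/
def pfaffian {R : Type*} [CommRing R] {m : ℕ} (A : Matrix (Fin (2 * m)) (Fin (2 * m)) R) : R :=
  ∑ ω : Equiv.Perm (Fin (2 * m)) with
      (∀ i : Fin m, ω ⟨2 * i, by omega⟩ < ω ⟨2 * i + 1, by omega⟩) ∧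
      (∀ i j : Fin m, i < j → ω ⟨2 * i, by omega⟩ < ω ⟨2 * j, by omega⟩),
    ((Equiv.Perm.sign ω : ℤ) : R) * ∏ i : Fin m, A (ω ⟨2 * i, by omega⟩) (ω ⟨2 * i + 1, by omega⟩)

/-! ### The algebra of supersymmetric functions -/

/-- A polynomial is supersymmetric if it is symmetric and if for any two of its variables the
substitution of `t` and `-t` for them gives a result which does not depend on `t`. -/
def IsSupersymmetric {n : ℕ} (f : MvPolynomial (Fin n) ℂ) : Prop :=
  f.IsSymmetric ∧
    ∀ i j : Fin n, i < j → ∀ (x : Fin n → ℂ) (s t : ℂ),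
      eval (Function.update (Function.update x i t) j (-t)) f =
        eval (Function.update (Function.update x i s) j (-s)) f

/-- The specialization `x_{n+1} = 0`. -/
noncomputable def specializeLast (n : ℕ) :
    MvPolynomial (Fin (n + 1)) ℂ →ₐ[ℂ] MvPolynomial (Fin n) ℂ :=
  aeval (Fin.snoc (α := fun _ => MvPolynomial (Fin n) ℂ) X 0)

/-- The algebra `Γ` of supersymmetric functions: the stable sequences `(f_n)` of supersymmetric
polynomials `f_n` in `n` variables, of bounded degree. (The constant `f_0`, which is determined
by `f_1`, is included in the sequence.) -/
noncomputable def Gam : Subalgebra ℂ ((n : ℕ) → MvPolynomial (Fin n) ℂ) where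
  carrier := {f | (∀ n, IsSupersymmetric (f n)) ∧ (∀ n, specializeLast n (f (n + 1)) = f n) ∧
    ∃ d : ℕ, ∀ n, (f n).totalDegree ≤ d}
  mul_mem' := by
    rintro f g ⟨hf, hf', d, hd⟩ ⟨hg, hg', e, he⟩
    refine ⟨fun n => ⟨(hf n).1.mul (hg n).1, fun i j hij x s t => ?_⟩, fun n => ?_, d + e,
      fun n => ?_⟩
    · simp only [Pi.mul_apply, map_mul, (hf n).2 i j hij x s t, (hg n).2 i j hij x s t]
    · simp only [Pi.mul_apply, map_mul, hf', hg']
    · exact (totalDegree_mul _ _).trans (add_le_add (hd n) (he n))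
  add_mem' := by
    rintro f g ⟨hf, hf', d, hd⟩ ⟨hg, hg', e, he⟩
    refine ⟨fun n => ⟨(hf n).1.add (hg n).1, fun i j hij x s t => ?_⟩, fun n => ?_, max d e,
      fun n => ?_⟩
    · simp only [Pi.add_apply, map_add, (hf n).2 i j hij x s t, (hg n).2 i j hij x s t]
    · simp only [Pi.add_apply, map_add, hf', hg']
    · exact (totalDegree_add _ _).trans (max_le_max (hd n) (he n))
  algebraMap_mem' := by
    intro r
    refine ⟨fun n => ⟨fun σ => ?_, fun i j hij x s t => ?_⟩, fun n => ?_, 0, fun n => ?_⟩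
    · simp [MvPolynomial.algebraMap_eq]
    · simp [MvPolynomial.algebraMap_eq]
    · simp [MvPolynomial.algebraMap_eq, specializeLast]
    · simp [MvPolynomial.algebraMap_eq]

/-! ### Strict partitions -/

/-- A strict partition `λ_1 > ... > λ_ℓ > 0`, given by the list of its non-zero parts. -/
structure StrictPartition where
  parts : List ℕ
  strict : parts.Pairwise (fun p q => q < p)
  pos : ∀ p ∈ parts, 0 < p

namespace StrictPartition

/-- The length `ℓ(λ)`. -/
def length (lam : StrictPartition) : ℕ := lam.parts.length

/-- `lam.part i` is `λ_{i+1}`; it is `0` for `i ≥ ℓ(λ)`. -/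
def part (lam : StrictPartition) (i : ℕ) : ℕ := lam.parts.getD i 0

/-- The strict partition `(k, l)`, where `k > l ≥ 0`; it has one non-zero part if `l = 0`. -/
def ofPair (k l : ℕ) (h : l < k) : StrictPartition where
  parts := if l = 0 then [k] else [k, l]
  strict := by split_ifs <;> simp [h]
  pos := by split_ifs <;> simp <;> omega

end StrictPartition

/-! ### The multiparameter P-function in `n` variables as a rational function -/

/-- The generalized power `(x | a)^n = (x - a_1) ... (x - a_n)`. -/
def genPow {R : Type*} [CommRing R] [Algebra ℂ R] (a : ℕ → ℂ) (x : R) (n : ℕ) : R :=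
  ∏ k ∈ Finset.Icc 1 n, (x - algebraMap ℂ R (a k))

/-- `∏_{i ≤ ℓ} (x_i | a)^{λ_i} * ∏_{i ≤ ℓ, i < j ≤ n} (x_i + x_j) / (x_i - x_j)`. -/
def summand {F : Type*} [Field F] [Algebra ℂ F] (a : ℕ → ℂ) (lam : StrictPartition) {n : ℕ}
    (x : Fin n → F) : F :=
  (∏ i : Fin n with i.val < lam.length, genPow a (x i) (lam.part i)) *
    ∏ i : Fin n with i.val < lam.length, ∏ j ∈ Finset.Ioi i, (x i + x j) / (x i - x j)

/-- The expression `(1 / (n - ℓ)!) * ∑_{ω ∈ S(n)} summand (x_{ω(1)}, ..., x_{ω(n)})` if `ℓ(λ) ≤ n`,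
and `0` if `ℓ(λ) > n`. -/
noncomputable def multPExpr {F : Type*} [Field F] [Algebra ℂ F] (a : ℕ → ℂ) (lam : StrictPartition)
    {n : ℕ} (x : Fin n → F) : F :=
  if lam.length ≤ n then
    ((Nat.factorial (n - lam.length) : ℕ) : F)⁻¹ *
      ∑ ω : Equiv.Perm (Fin n), summand a lam (fun i => x (ω i))
  else 0

/-- The field of rational functions in `n` variables. -/
abbrev RatFun (n : ℕ) : Type := FractionRing (MvPolynomial (Fin n) ℂ)

/-- The variables, as rational functions. -/
noncomputable def ratVar (n : ℕ) (i : Fin n) : RatFun n :=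
  algebraMap (MvPolynomial (Fin n) ℂ) (RatFun n) (X i)

/-! ### The expression is a polynomial -/

/-- `summand` times the Vandermonde determinant. -/
def numer {R : Type*} [CommRing R] [Algebra ℂ R] (a : ℕ → ℂ) (lam : StrictPartition) {n : ℕ}
    (x : Fin n → R) : R :=
  (∏ i : Fin n with i.val < lam.length, genPow a (x i) (lam.part i)) *
    ∏ i : Fin n, ∏ j ∈ Finset.Ioi i,
      if i.val < lam.length then -(x i + x j) else x j - x i

/-- The antisymmetrization of `numer`. -/
def altNumer {R : Type*} [CommRing R] [Algebra ℂ R] (a : ℕ → ℂ) (lam : StrictPartition) {n : ℕ}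
    (x : Fin n → R) : R :=
  ∑ ω : Equiv.Perm (Fin n), ((Equiv.Perm.sign ω : ℤ) : R) * numer a lam (fun i => x (ω i))

theorem map_genPow {R S : Type*} [CommRing R] [Algebra ℂ R] [CommRing S] [Algebra ℂ S]
    (φ : R →ₐ[ℂ] S) (a : ℕ → ℂ) (x : R) (n : ℕ) : φ (genPow a x n) = genPow a (φ x) n := by
  simp [genPow, map_prod]

theorem map_altNumer {R S : Type*} [CommRing R] [Algebra ℂ R] [CommRing S] [Algebra ℂ S]
    (φ : R →ₐ[ℂ] S) (a : ℕ → ℂ) (lam : StrictPartition) {n : ℕ} (x : Fin n → R) :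
    φ (altNumer a lam x) = altNumer a lam (fun i => φ (x i)) := by
  simp only [altNumer, numer, map_sum, map_mul, map_prod, map_genPow, map_intCast]
  refine Finset.sum_congr rfl fun ω _ => ?_
  congr 2
  refine Finset.prod_congr rfl fun i _ => Finset.prod_congr rfl fun j _ => ?_
  split_ifs <;> simp

theorem altNumer_perm {R : Type*} [CommRing R] [Algebra ℂ R] (a : ℕ → ℂ) (lam : StrictPartition)
    {n : ℕ} (x : Fin n → R) (σ : Equiv.Perm (Fin n)) :
    altNumer a lam (fun i => x (σ i)) = ((Equiv.Perm.sign σ : ℤ) : R) * altNumer a lam x := by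
  simp only [altNumer, Finset.mul_sum]
  refine Fintype.sum_equiv (Equiv.mulLeft σ) _ _ fun ω => ?_
  simp only [Equiv.coe_mulLeft, Equiv.Perm.sign_mul, Equiv.Perm.coe_mul, Function.comp_apply,
    Units.val_mul, Int.cast_mul, ← mul_assoc]
  congr 1
  rw [← Int.cast_mul, ← Units.val_mul, Int.units_mul_self]
  simp

theorem summand_mul_det {F : Type*} [Field F] [Algebra ℂ F] (a : ℕ → ℂ) (lam : StrictPartition)
    {n : ℕ} (x : Fin n → F) (hx : Function.Injective x) :
    summand a lam x * (Matrix.vandermonde x).det = numer a lam x := by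
  rw [summand, numer, mul_assoc, Matrix.det_vandermonde]
  congr 1
  rw [Finset.prod_filter, ← Finset.prod_mul_distrib]
  refine Finset.prod_congr rfl fun i _ => ?_
  split_ifs with h
  · rw [← Finset.prod_mul_distrib]
    refine Finset.prod_congr rfl fun j hj => ?_
    have hne : x i - x j ≠ 0 := by
      rw [sub_ne_zero]
      exact fun e => (Finset.mem_Ioi.1 hj).ne (hx e)
    field_simp
    ring
  · rw [one_mul]

theorem sum_summand_mul_det {F : Type*} [Field F] [Algebra ℂ F] (a : ℕ → ℂ)
    (lam : StrictPartition) {n : ℕ} (x : Fin n → F) (hx : Function.Injective x) :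
    (∑ ω : Equiv.Perm (Fin n), summand a lam (fun i => x (ω i))) * (Matrix.vandermonde x).det =
      altNumer a lam x := by
  rw [altNumer, Finset.sum_mul]
  refine Finset.sum_congr rfl fun ω _ => ?_
  rw [← summand_mul_det a lam (fun i => x (ω i)) (hx.comp ω.injective)]
  have h : (Matrix.vandermonde (fun i => x (ω i))).det =
      ((Equiv.Perm.sign ω : ℤ) : F) * (Matrix.vandermonde x).det := by
    rw [← Matrix.det_permute]
    rfl
  rw [h, mul_left_comm, ← mul_assoc ((Equiv.Perm.sign ω : ℤ) : F), ← Int.cast_mul,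
    ← Units.val_mul, Int.units_mul_self]
  simp

theorem sub_dvd_iff {n : ℕ} (i j : Fin n) (hij : i ≠ j) (G : MvPolynomial (Fin n) ℂ) :
    X j - X i ∣ G ↔ aeval (Function.update (X : Fin n → MvPolynomial (Fin n) ℂ) j (X i)) G = 0 := by
  constructor
  · rintro ⟨H, rfl⟩
    simp [Function.update_of_ne hij]
  · intro h
    have key : ((Ideal.Quotient.mkₐ ℂ (Ideal.span {(X j - X i : MvPolynomial (Fin n) ℂ)})).comp
        (aeval (Function.update (X : Fin n → MvPolynomial (Fin n) ℂ) j (X i)))) =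
        Ideal.Quotient.mkₐ ℂ (Ideal.span {(X j - X i : MvPolynomial (Fin n) ℂ)}) := by
      refine MvPolynomial.algHom_ext fun k => ?_
      by_cases hk : k = j
      · subst hk
        simp only [AlgHom.comp_apply, aeval_X, Function.update_self, Ideal.Quotient.mkₐ_eq_mk]
        rw [eq_comm, Ideal.Quotient.eq]
        exact Ideal.mem_span_singleton_self _
      · simp [Function.update_of_ne hk]
    have h2 := DFunLike.congr_fun key G
    rw [AlgHom.comp_apply, h, map_zero, Ideal.Quotient.mkₐ_eq_mk, eq_comm,
      Ideal.Quotient.eq_zero_iff_mem, Ideal.mem_span_singleton] at h2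
    exact h2

theorem prime_sub {n : ℕ} (i j : Fin n) (hij : i ≠ j) :
    Prime (X j - X i : MvPolynomial (Fin n) ℂ) := by
  refine ⟨fun h => ?_, fun h => ?_, fun p q h => ?_⟩
  · exact hij (MvPolynomial.X_injective (sub_eq_zero.1 h)).symm
  · have := (sub_dvd_iff i j hij 1).1 h.dvd
    simp at this
  · rw [sub_dvd_iff i j hij, map_mul, mul_eq_zero] at h
    rwa [sub_dvd_iff i j hij, sub_dvd_iff i j hij]

theorem det_dvd {n : ℕ} (G : MvPolynomial (Fin n) ℂ)
    (hG : ∀ σ : Equiv.Perm (Fin n), aeval (fun i => X (σ i)) G =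
      ((Equiv.Perm.sign σ : ℤ) : MvPolynomial (Fin n) ℂ) * G) :
    (Matrix.vandermonde (X : Fin n → MvPolynomial (Fin n) ℂ)).det ∣ G := by
  rw [Matrix.det_vandermonde, Finset.prod_sigma']
  refine Finset.prod_dvd_of_isRelPrime ?_ ?_
  · rintro ⟨i, j⟩ hij ⟨k, l⟩ hkl hne
    simp only [Finset.coe_sigma, Set.mem_sigma_iff, Finset.coe_univ, Set.mem_univ, true_and,
      Finset.coe_Ioi, Set.mem_Ioi] at hij hkl
    simp only [Function.onFun]
    rw [(prime_sub i j hij.ne).irreducible.isRelPrime_iff_not_dvd, sub_dvd_iff i j hij.ne]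
    simp only [map_sub, aeval_X, sub_eq_zero]
    intro h
    apply hne
    have hX : ∀ u v : Fin n, (X u : MvPolynomial (Fin n) ℂ) = X v → u = v :=
      fun u v e => MvPolynomial.X_injective e
    by_cases h1 : l = j
    · subst h1
      rw [Function.update_self, Function.update_of_ne hkl.ne] at h
      rw [hX _ _ h]
    · rw [Function.update_of_ne h1] at h
      by_cases h2 : k = j
      · subst h2
        rw [Function.update_self] at h
        have := hX _ _ h
        omega
      · rw [Function.update_of_ne h2] at h
        exact absurd (hX _ _ h) hkl.ne'
  · rintro ⟨i, j⟩ hij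
    simp only [Finset.mem_sigma, Finset.mem_univ, true_and, Finset.mem_Ioi] at hij
    rw [sub_dvd_iff i j hij.ne]
    have h := hG (Equiv.swap i j)
    rw [Equiv.Perm.sign_swap hij.ne] at h
    have h3 := congrArg (aeval (Function.update (X : Fin n → MvPolynomial (Fin n) ℂ) j (X i))) h
    rw [← AlgHom.comp_apply] at h3
    have h4 : (aeval (Function.update (X : Fin n → MvPolynomial (Fin n) ℂ) j (X i))).comp
        (aeval (R := ℂ) (fun u => X (Equiv.swap i j u))) =
        aeval (Function.update (X : Fin n → MvPolynomial (Fin n) ℂ) j (X i)) := by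
      refine MvPolynomial.algHom_ext fun k => ?_
      simp only [AlgHom.comp_apply, aeval_X]
      by_cases hk : k = j
      · subst hk
        simp [Function.update_of_ne hij.ne]
      · by_cases hk' : k = i
        · subst hk'
          simp [Function.update_of_ne hij.ne]
        · rw [Equiv.swap_apply_of_ne_of_ne hk' hk]
    rw [h4] at h3
    simp only [Units.val_neg, Units.val_one, Int.cast_neg, Int.cast_one, neg_mul, one_mul,
      map_neg] at h3
    exact self_eq_neg.1 h3

/-- The expression defining the multiparameter P-function is a polynomial in `x_1, ..., x_n`. -/
theorem exists_polynomial (a : ℕ → ℂ) (lam : StrictPartition) (n : ℕ) :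
    ∃ f : MvPolynomial (Fin n) ℂ,
      algebraMap (MvPolynomial (Fin n) ℂ) (RatFun n) f = multPExpr a lam (ratVar n) := by
  by_cases hl : lam.length ≤ n
  swap
  · exact ⟨0, by simp [multPExpr, hl]⟩
  obtain ⟨f, hf⟩ := det_dvd (altNumer a lam (X : Fin n → MvPolynomial (Fin n) ℂ)) fun σ => by
    rw [map_altNumer]
    simp only [aeval_X]
    exact altNumer_perm a lam X σ
  have hinj : Function.Injective (ratVar n) :=
    (IsFractionRing.injective (MvPolynomial (Fin n) ℂ) (RatFun n)).comp MvPolynomial.X_injective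
  have h1 := sum_summand_mul_det a lam (ratVar n) hinj
  have h2 := congrArg (IsScalarTower.toAlgHom ℂ (MvPolynomial (Fin n) ℂ) (RatFun n)) hf
  rw [map_altNumer, map_mul, AlgHom.map_det] at h2
  have h3 : (IsScalarTower.toAlgHom ℂ (MvPolynomial (Fin n) ℂ) (RatFun n)).mapMatrix
      (Matrix.vandermonde X) = Matrix.vandermonde (ratVar n) := by
    ext i j
    simp [Matrix.vandermonde, ratVar]
  rw [h3] at h2
  have h4 : (Matrix.vandermonde (ratVar n)).det ≠ 0 := Matrix.det_vandermonde_ne_zero_iff.2 hinj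
  change altNumer a lam (ratVar n) = _ at h2
  rw [← h1, mul_comm] at h2
  have h5 := mul_left_cancel₀ h4 h2
  refine ⟨C ((Nat.factorial (n - lam.length) : ℂ)⁻¹) * f, ?_⟩
  rw [multPExpr, if_pos hl, h5, map_mul]
  congr 1
  rw [← MvPolynomial.algebraMap_eq, ← IsScalarTower.algebraMap_apply ℂ (MvPolynomial (Fin n) ℂ)
    (RatFun n), map_inv₀, map_natCast]

/-- The multiparameter P-polynomial `P_{λ;a|n}` in `n` variables. -/
noncomputable def multPPoly (a : ℕ → ℂ) (lam : StrictPartition) (n : ℕ) :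
    MvPolynomial (Fin n) ℂ :=
  Classical.choose (exists_polynomial a lam n)

theorem algebraMap_multPPoly (a : ℕ → ℂ) (lam : StrictPartition) (n : ℕ) :
    algebraMap (MvPolynomial (Fin n) ℂ) (RatFun n) (multPPoly a lam n) =
      multPExpr a lam (ratVar n) :=
  Classical.choose_spec (exists_polynomial a lam n)

theorem ratVar_injective (n : ℕ) : Function.Injective (ratVar n) :=
  (IsFractionRing.injective (MvPolynomial (Fin n) ℂ) (RatFun n)).comp MvPolynomial.X_injective

theorem multPPoly_eq_zero (a : ℕ → ℂ) (lam : StrictPartition) (n : ℕ) (hl : ¬lam.length ≤ n) :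
    multPPoly a lam n = 0 := by
  have h0 := algebraMap_multPPoly a lam n
  rw [multPExpr, if_neg hl] at h0
  exact (IsFractionRing.injective (MvPolynomial (Fin n) ℂ) (RatFun n))
    (h0.trans (map_zero _).symm)

theorem multPPoly_mul_det (a : ℕ → ℂ) (lam : StrictPartition) (n : ℕ) (hl : lam.length ≤ n) :
    (Nat.factorial (n - lam.length) : MvPolynomial (Fin n) ℂ) * multPPoly a lam n *
      (Matrix.vandermonde (X : Fin n → MvPolynomial (Fin n) ℂ)).det = altNumer a lam X := by
  have h3 : (IsScalarTower.toAlgHom ℂ (MvPolynomial (Fin n) ℂ) (RatFun n)).mapMatrix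
      (Matrix.vandermonde X) = Matrix.vandermonde (ratVar n) := by
    ext i j
    simp [Matrix.vandermonde, ratVar]
  apply IsFractionRing.injective (MvPolynomial (Fin n) ℂ) (RatFun n)
  change IsScalarTower.toAlgHom ℂ (MvPolynomial (Fin n) ℂ) (RatFun n) _ =
    IsScalarTower.toAlgHom ℂ (MvPolynomial (Fin n) ℂ) (RatFun n) _
  rw [map_altNumer, map_mul, AlgHom.map_det, h3, map_mul, map_natCast]
  change _ * (algebraMap (MvPolynomial (Fin n) ℂ) (RatFun n) _) * _ = altNumer a lam (ratVar n)
  rw [algebraMap_multPPoly, ← sum_summand_mul_det a lam (ratVar n) (ratVar_injective n), multPExpr,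
    if_pos hl, mul_inv_cancel_left₀]
  exact_mod_cast Nat.factorial_ne_zero _

/-- At a point with distinct coordinates, the polynomial takes the value of the expression. -/
theorem aeval_multPPoly {F : Type*} [Field F] [Algebra ℂ F] (a : ℕ → ℂ) (lam : StrictPartition)
    {n : ℕ} (x : Fin n → F) (hx : Function.Injective x) :
    aeval x (multPPoly a lam n) = multPExpr a lam x := by
  by_cases hl : lam.length ≤ n
  swap
  · rw [multPPoly_eq_zero a lam n hl, map_zero, multPExpr, if_neg hl]
  have h2 := congrArg (aeval (R := ℂ) x) (multPPoly_mul_det a lam n hl)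
  have h4 : (aeval (R := ℂ) x).mapMatrix (Matrix.vandermonde X) = Matrix.vandermonde x := by
    ext i j
    simp [Matrix.vandermonde]
  rw [map_altNumer, map_mul, AlgHom.map_det, h4, map_mul, map_natCast] at h2
  simp only [aeval_X] at h2
  rw [← sum_summand_mul_det a lam x hx] at h2
  have h5 := mul_right_cancel₀ (Matrix.det_vandermonde_ne_zero_iff.2 hx) h2
  have : CharZero F := charZero_of_injective_algebraMap (algebraMap ℂ F).injective
  rw [multPExpr, if_pos hl, ← h5, inv_mul_cancel_left₀]
  exact_mod_cast Nat.factorial_ne_zero _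

/-! ### The polynomials form a supersymmetric function -/

theorem multPPoly_isSymmetric (a : ℕ → ℂ) (lam : StrictPartition) (n : ℕ) :
    (multPPoly a lam n).IsSymmetric := by
  intro σ
  apply IsFractionRing.injective (MvPolynomial (Fin n) ℂ) (RatFun n)
  change IsScalarTower.toAlgHom ℂ (MvPolynomial (Fin n) ℂ) (RatFun n) _ = _
  have h : ((IsScalarTower.toAlgHom ℂ (MvPolynomial (Fin n) ℂ) (RatFun n)).comp (rename σ)) =
      aeval (fun i => ratVar n (σ i)) := by
    refine MvPolynomial.algHom_ext fun k => ?_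
    simp [ratVar]
  rw [← AlgHom.comp_apply, h, aeval_multPPoly a lam (fun i => ratVar n (σ i))
    ((ratVar_injective n).comp σ.injective), algebraMap_multPPoly, multPExpr, multPExpr]
  congr 2
  exact Fintype.sum_equiv (Equiv.mulLeft σ) _ _ fun ω => rfl

theorem summand_eq_of_pair {F : Type*} [Field F] [Algebra ℂ F] (a : ℕ → ℂ)
    (lam : StrictPartition) {n : ℕ} (x y : Fin n → F) (hx : Function.Injective x)
    (hy : Function.Injective y) (p q : Fin n) (hpq : p < q) (hxpq : x q = - x p)
    (hypq : y q = - y p) (hxy : ∀ k, k ≠ p → k ≠ q → x k = y k) :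
    summand a lam x = summand a lam y := by
  by_cases hp : p.val < lam.length
  · have h0 : ∀ z : Fin n → F, z q = - z p → summand a lam z = 0 := by
      intro z hz
      have h1 : ∏ j ∈ Finset.Ioi p, (z p + z j) / (z p - z j) = 0 :=
        Finset.prod_eq_zero (Finset.mem_Ioi.2 hpq) (by simp [hz])
      rw [summand, mul_eq_zero]
      exact Or.inr (Finset.prod_eq_zero (Finset.mem_filter.2 ⟨Finset.mem_univ p, hp⟩) h1)
    rw [h0 x hxpq, h0 y hypq]
  · rw [summand, summand]
    have hne : ∀ i : Fin n, i.val < lam.length → i < p ∧ i ≠ p ∧ i ≠ q := by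
      intro i hi
      have h1 : i < p := by omega
      exact ⟨h1, h1.ne, (h1.trans hpq).ne⟩
    congr 1
    · refine Finset.prod_congr rfl fun i hi => ?_
      obtain ⟨-, h2, h3⟩ := hne i (by simpa using hi)
      rw [hxy i h2 h3]
    · refine Finset.prod_congr rfl fun i hi => ?_
      obtain ⟨h1, h2, h3⟩ := hne i (by simpa using hi)
      have hs : ∀ z : Fin n → F, Function.Injective z → z q = - z p →
          ∏ j ∈ Finset.Ioi i, (z i + z j) / (z i - z j) =
            ∏ j ∈ ((Finset.Ioi i).erase q).erase p, (z i + z j) / (z i - z j) := by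
        intro z hz hzz
        rw [← Finset.mul_prod_erase _ _ (Finset.mem_Ioi.2 (h1.trans hpq)),
          ← Finset.mul_prod_erase ((Finset.Ioi i).erase q) _
            (Finset.mem_erase.2 ⟨hpq.ne, Finset.mem_Ioi.2 h1⟩), ← mul_assoc, hzz]
        have e1 : z i - z p ≠ 0 := sub_ne_zero.2 fun e => h2 (hz e)
        have e2 : z i + z p ≠ 0 := by
          have : z i - z q ≠ 0 := sub_ne_zero.2 fun e => h3 (hz e)
          rwa [hzz, sub_neg_eq_add] at this
        have e3 : (z i - z p) / (z i + z p) * ((z i + z p) / (z i - z p)) = 1 := by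
          field_simp
        rw [sub_neg_eq_add, ← sub_eq_add_neg, e3, one_mul]
      rw [hs x hx hxpq, hs y hy hypq]
      refine Finset.prod_congr rfl fun j hj => ?_
      simp only [Finset.mem_erase] at hj
      rw [hxy i h2 h3, hxy j hj.1 hj.2.1]

theorem multPExpr_eq_of_pair {F : Type*} [Field F] [Algebra ℂ F] (a : ℕ → ℂ)
    (lam : StrictPartition) {n : ℕ} (x y : Fin n → F) (hx : Function.Injective x)
    (hy : Function.Injective y) (p q : Fin n) (hpq : p ≠ q) (hxpq : x q = - x p)
    (hypq : y q = - y p) (hxy : ∀ k, k ≠ p → k ≠ q → x k = y k) :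
    multPExpr a lam x = multPExpr a lam y := by
  rw [multPExpr, multPExpr]
  congr 2
  refine Finset.sum_congr rfl fun ω _ => ?_
  have hxy' : ∀ k, k ≠ ω.symm p → k ≠ ω.symm q → x (ω k) = y (ω k) := fun k h1 h2 =>
    hxy _ (fun e => h1 (by simp [← e])) (fun e => h2 (by simp [← e]))
  rcases lt_or_gt_of_ne (ω.symm.injective.ne hpq) with h | h
  · exact summand_eq_of_pair a lam _ _ (hx.comp ω.injective) (hy.comp ω.injective) _ _ h
      (by simpa using hxpq) (by simpa using hypq) hxy'
  · exact summand_eq_of_pair a lam _ _ (hx.comp ω.injective) (hy.comp ω.injective) _ _ h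
      (by simp [hxpq]) (by simp [hypq]) (fun k h1 h2 => hxy' k h2 h1)

theorem multPPoly_isSupersymmetric (a : ℕ → ℂ) (lam : StrictPartition) (n : ℕ) :
    IsSupersymmetric (multPPoly a lam n) := by
  refine ⟨multPPoly_isSymmetric a lam n, fun i j hij x s t => ?_⟩
  have hXinj : ∀ u v : Fin n, (X u : MvPolynomial (Fin n) ℂ) = X v → u = v :=
    fun u v e => MvPolynomial.X_injective e
  have hXneg : ∀ u v : Fin n, (X u : MvPolynomial (Fin n) ℂ) ≠ -X v := by
    intro u v e
    have := congrArg (eval (fun _ => (1 : ℂ))) e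
    simp only [eval_X, map_neg] at this
    norm_num at this
  let y : Fin n → Fin n → MvPolynomial (Fin n) ℂ := fun k =>
    Function.update (Function.update X i (X k)) j (-X k)
  have hyj : ∀ k, y k j = -X k := fun k => Function.update_self _ _ _
  have hyi : ∀ k, y k i = X k := fun k => by
    simp only [y]
    rw [Function.update_of_ne hij.ne, Function.update_self]
  have hyu : ∀ k u, u ≠ i → u ≠ j → y k u = X u := fun k u h1 h2 => by
    simp only [y]
    rw [Function.update_of_ne h2, Function.update_of_ne h1]
  have hinj : ∀ k : Fin n, (k = i ∨ k = j) → Function.Injective (y k) := by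
    intro k hk
    have hne : ∀ u, u ≠ j → y k u ≠ -X k := by
      intro u hu
      by_cases h : u = i
      · rw [h, hyi]
        exact hXneg _ _
      · rw [hyu k u h hu]
        exact hXneg _ _
    have hne' : ∀ u, u ≠ i → u ≠ j → y k u ≠ X k := by
      intro u h1 h2 e
      rw [hyu k u h1 h2] at e
      have := hXinj _ _ e
      rcases hk with hk | hk
      · exact h1 (this.trans hk)
      · exact h2 (this.trans hk)
    intro u v huv
    by_cases hu : u = j
    · by_contra hv
      refine hne v (fun e => hv (hu.trans e.symm)) ?_
      rw [← huv, hu, hyj]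
    by_cases hv : v = j
    · refine absurd ?_ (hne u hu)
      rw [huv, hv, hyj]
    by_cases hu' : u = i
    · by_contra hvi
      refine hne' v (fun e => hvi (hu'.trans e.symm)) hv ?_
      rw [← huv, hu', hyi]
    by_cases hv' : v = i
    · refine absurd ?_ (hne' u hu' hu)
      rw [huv, hv', hyi]
    rw [hyu k u hu' hu, hyu k v hv' hv] at huv
    exact hXinj _ _ huv
  have hpoly : aeval (y i) (multPPoly a lam n) = aeval (y j) (multPPoly a lam n) := by
    have hfi := IsFractionRing.injective (MvPolynomial (Fin n) ℂ) (RatFun n)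
    have hcomp : ∀ k, algebraMap (MvPolynomial (Fin n) ℂ) (RatFun n)
        (aeval (y k) (multPPoly a lam n)) =
        aeval (fun u => algebraMap (MvPolynomial (Fin n) ℂ) (RatFun n) (y k u))
          (multPPoly a lam n) := by
      intro k
      change IsScalarTower.toAlgHom ℂ (MvPolynomial (Fin n) ℂ) (RatFun n) _ = _
      rw [← AlgHom.comp_apply, comp_aeval]
      rfl
    apply hfi
    rw [hcomp, hcomp]
    refine (aeval_multPPoly a lam _ (hfi.comp (hinj i (Or.inl rfl)))).trans
      (Eq.trans ?_ (aeval_multPPoly a lam _ (hfi.comp (hinj j (Or.inr rfl)))).symm)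
    refine multPExpr_eq_of_pair a lam _ _ (hfi.comp (hinj i (Or.inl rfl)))
      (hfi.comp (hinj j (Or.inr rfl))) i j hij.ne ?_ ?_ ?_
    · simp only [Function.comp_apply, hyi, hyj, map_neg]
    · simp only [Function.comp_apply, hyi, hyj, map_neg]
    · intro k h1 h2
      simp only [Function.comp_apply, hyu _ k h1 h2]
  let z : Fin n → ℂ := Function.update (Function.update x i t) j s
  have hz : ∀ k, eval z (aeval (y k) (multPPoly a lam n)) =
      eval (Function.update (Function.update x i (z k)) j (-z k)) (multPPoly a lam n) := by
    intro k
    rw [← coe_aeval_eq_eval, ← coe_aeval_eq_eval, RingHom.coe_coe, RingHom.coe_coe,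
      ← AlgHom.comp_apply, comp_aeval]
    congr 2
    funext u
    by_cases h2 : u = j
    · rw [h2, hyj, Function.update_self, map_neg, aeval_X]
    by_cases h1 : u = i
    · rw [h1, hyi, Function.update_of_ne hij.ne, Function.update_self, aeval_X]
    rw [hyu k u h1 h2, Function.update_of_ne h2, Function.update_of_ne h1, aeval_X]
    simp only [z]
    rw [Function.update_of_ne h2, Function.update_of_ne h1]
  have h := congrArg (eval z) hpoly
  rw [hz, hz] at h
  have hzi : z i = t := by
    simp only [z]
    rw [Function.update_of_ne hij.ne, Function.update_self]
  have hzj : z j = s := Function.update_self _ _ _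
  rwa [hzi, hzj] at h

theorem StrictPartition.part_pos (lam : StrictPartition) (i : ℕ) (hi : i < lam.length) :
    0 < lam.part i := by
  rw [StrictPartition.part, List.getD_eq_getElem _ _ hi]
  exact lam.pos _ (List.getElem_mem _)

theorem summand_eq_zero {F : Type*} [Field F] [Algebra ℂ F] (a : ℕ → ℂ) (ha : a 1 = 0)
    (lam : StrictPartition) {n : ℕ} (x : Fin n → F) (p : Fin n) (hp : p.val < lam.length)
    (hx : x p = 0) : summand a lam x = 0 := by
  have h : genPow a (x p) (lam.part p) = 0 :=
    Finset.prod_eq_zero (i := 1) (Finset.mem_Icc.2 ⟨le_rfl, lam.part_pos p hp⟩) (by simp [ha, hx])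
  rw [summand, Finset.prod_eq_zero (i := p) (by simp [hp]) h, zero_mul]

theorem summand_perm {F : Type*} [Field F] [Algebra ℂ F] (a : ℕ → ℂ) (lam : StrictPartition)
    {n : ℕ} (x : Fin n → F) (τ : Equiv.Perm (Fin n))
    (hτ : ∀ i : Fin n, i.val < lam.length → τ i = i) :
    summand a lam (fun i => x (τ i)) = summand a lam x := by
  rw [summand, summand]
  congr 1
  · refine Finset.prod_congr rfl fun i hi => ?_
    rw [hτ i (by simpa using hi)]
  · refine Finset.prod_congr rfl fun i hi => ?_
    have hi' : i.val < lam.length := by simpa using hi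
    rw [hτ i hi']
    refine Finset.prod_equiv τ (fun j => ?_) fun j _ => rfl
    simp only [Finset.mem_Ioi]
    constructor
    · intro h
      by_contra h2
      have h3 : (τ j).val < lam.length := by omega
      have := τ.injective (hτ _ h3)
      omega
    · intro h
      by_contra h2
      have h3 : j.val < lam.length := by omega
      rw [hτ _ h3] at h
      exact h2 h

theorem summand_snoc {F : Type*} [Field F] [Algebra ℂ F] (a : ℕ → ℂ) (lam : StrictPartition)
    {n : ℕ} (hl : lam.length ≤ n) (x : Fin n → F) (hx : ∀ i, x i ≠ 0) :
    summand a lam (Fin.snoc (α := fun _ => F) x 0) = summand a lam x := by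
  rw [summand, summand]
  simp only [← Finset.filter_lt_eq_Ioi, Finset.prod_filter]
  rw [Fin.prod_univ_castSucc, Fin.prod_univ_castSucc]
  simp only [Fin.val_castSucc, Fin.snoc_castSucc, Fin.val_last, if_neg (not_lt.2 hl), mul_one]
  congr 1
  refine Finset.prod_congr rfl fun i _ => ?_
  split_ifs with h
  · rw [Fin.prod_univ_castSucc]
    simp [Fin.castSucc_lt_last, div_self (hx i)]
  · rfl

theorem sum_summand_snoc {F : Type*} [Field F] [Algebra ℂ F] (a : ℕ → ℂ) (ha : a 1 = 0)
    (lam : StrictPartition) {n : ℕ} (hl : lam.length ≤ n) (x : Fin n → F) (hx : ∀ i, x i ≠ 0) :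
    ∑ ω : Equiv.Perm (Fin (n + 1)), summand a lam
        (fun i => Fin.snoc (α := fun _ => F) x 0 (ω i)) =
      ((n + 1 - lam.length : ℕ) : F) *
        ∑ ω : Equiv.Perm (Fin n), summand a lam (fun i => x (ω i)) := by
  let e : Fin (n + 1) ≃ Option (Fin n) := finSuccEquivLast
  let E : Option (Fin n) × Equiv.Perm (Fin n) ≃ Equiv.Perm (Fin (n + 1)) :=
    (Equiv.Perm.decomposeOption.symm.trans (Equiv.inv _)).trans e.symm.permCongr
  have hE : ∀ (p : Fin (n + 1)) (σ : Equiv.Perm (Fin n)) (i : Fin (n + 1)),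
      Fin.snoc (α := fun _ => F) x 0 (E (e p, σ) i) =
        Fin.snoc (α := fun _ => F) (fun i => x (σ.symm i)) 0
          (Equiv.swap (Fin.last n) p i) := by
    intro p σ i
    have h1 : E (e p, σ) i = e.symm (σ.symm.optionCongr (Equiv.swap none (e p) (e i))) := rfl
    have h2 : ∀ (y : Fin n → F) (o : Option (Fin n)),
        Fin.snoc (α := fun _ => F) y 0 (e.symm o) = o.elim 0 y := by
      intro y o
      cases o <;> simp [e]
    have h3 : Equiv.swap none (e p) (e i) = e (Equiv.swap (Fin.last n) p i) := by
      rw [show (none : Option (Fin n)) = e (Fin.last n) by simp [e]]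
      exact (e.injective.map_swap _ _ _).symm
    have h4 := h2 (fun i => x (σ.symm i)) (e (Equiv.swap (Fin.last n) p i))
    rw [e.symm_apply_apply] at h4
    rw [h1, h2, h3, h4]
    cases e (Equiv.swap (Fin.last n) p i) <;> rfl
  rw [← E.sum_comp, Fintype.sum_prod_type, ← e.sum_comp]
  have hp : ∀ p : Fin (n + 1), ∑ σ : Equiv.Perm (Fin n),
      summand a lam (fun i => Fin.snoc (α := fun _ => F) x 0 (E (e p, σ) i)) =
      if p.val < lam.length then 0 else
        ∑ ω : Equiv.Perm (Fin n), summand a lam (fun i => x (ω i)) := by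
    intro p
    simp only [hE]
    split_ifs with h
    · refine Finset.sum_eq_zero fun σ _ => ?_
      exact summand_eq_zero a ha lam _ p h (by simp)
    · refine Fintype.sum_equiv (Equiv.inv _) _ _ fun σ => ?_
      rw [summand_perm a lam (Fin.snoc (α := fun _ => F) (fun i => x (σ.symm i)) 0),
        summand_snoc a lam hl _ fun i => hx _]
      · rfl
      · intro i hi
        apply Equiv.swap_apply_of_ne_of_ne
        · rintro rfl
          simp at hi
          omega
        · rintro rfl
          exact h hi
  simp only [hp]
  rw [Finset.sum_ite, Finset.sum_const_zero, zero_add, Finset.sum_const, nsmul_eq_mul]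
  congr 2
  have h1 := Finset.card_filter_add_card_filter_not (s := (Finset.univ : Finset (Fin (n + 1))))
    (fun p => p.val < lam.length)
  rw [Fin.card_filter_val_lt, Finset.card_univ, Fintype.card_fin] at h1
  omega

theorem multPExpr_snoc {F : Type*} [Field F] [Algebra ℂ F] (a : ℕ → ℂ) (ha : a 1 = 0)
    (lam : StrictPartition) {n : ℕ} (x : Fin n → F) (hx : ∀ i, x i ≠ 0) :
    multPExpr a lam (Fin.snoc (α := fun _ => F) x 0) = multPExpr a lam x := by
  have : CharZero F := charZero_of_injective_algebraMap (algebraMap ℂ F).injective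
  rw [multPExpr, multPExpr]
  by_cases hl : lam.length ≤ n
  · rw [if_pos hl, if_pos (by omega), sum_summand_snoc a ha lam hl x hx, Nat.sub_add_comm hl,
      Nat.factorial_succ, Nat.cast_mul, mul_inv_rev, mul_assoc, inv_mul_cancel_left₀]
    exact_mod_cast Nat.succ_ne_zero (n - lam.length)
  · rw [if_neg hl]
    split_ifs with h
    · rw [Finset.sum_eq_zero, mul_zero]
      intro ω _
      refine summand_eq_zero a ha lam _ (ω.symm (Fin.last n)) (by omega) (by simp)
    · rfl

theorem specializeLast_multPPoly (a : ℕ → ℂ) (ha : a 1 = 0) (lam : StrictPartition) (n : ℕ) :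
    specializeLast n (multPPoly a lam (n + 1)) = multPPoly a lam n := by
  have hx : ∀ i, ratVar n i ≠ 0 := fun i h => by
    have := IsFractionRing.injective (MvPolynomial (Fin n) ℂ) (RatFun n) (h.trans (map_zero _).symm)
    exact X_ne_zero i this
  have hinj : Function.Injective (Fin.snoc (α := fun _ => RatFun n) (ratVar n) 0) :=
    Fin.snoc_injective_of_injective (ratVar_injective n) (by rintro ⟨i, hi⟩; exact hx i hi)
  apply IsFractionRing.injective (MvPolynomial (Fin n) ℂ) (RatFun n)
  rw [algebraMap_multPPoly, ← multPExpr_snoc a ha lam _ hx, ← aeval_multPPoly a lam _ hinj]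
  change IsScalarTower.toAlgHom ℂ (MvPolynomial (Fin n) ℂ) (RatFun n) _ = _
  rw [specializeLast, ← AlgHom.comp_apply, comp_aeval]
  congr 2
  funext i
  refine Fin.lastCases ?_ (fun i => ?_) i
  · simp
  · simp [ratVar]

theorem totalDegree_genPow (a : ℕ → ℂ) {n : ℕ} (i : Fin n) (k : ℕ) :
    (genPow a (X i : MvPolynomial (Fin n) ℂ) k).totalDegree ≤ k := by
  refine (totalDegree_finsetProd _ _).trans ((Finset.sum_le_card_nsmul _ _ 1 fun j _ => ?_).trans
    (by simp))
  rw [MvPolynomial.algebraMap_eq]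
  exact (totalDegree_sub_C_le _ _).trans (totalDegree_X _).le

theorem totalDegree_multPPoly (a : ℕ → ℂ) (lam : StrictPartition) (n : ℕ) :
    (multPPoly a lam n).totalDegree ≤ ∑ i ∈ Finset.range lam.length, lam.part i := by
  by_cases hl : lam.length ≤ n
  swap
  · simp [multPPoly_eq_zero a lam n hl]
  by_cases hf : multPPoly a lam n = 0
  · simp [hf]
  have hD : (Matrix.vandermonde (X : Fin n → MvPolynomial (Fin n) ℂ)).det ≠ 0 :=
    Matrix.det_vandermonde_ne_zero_iff.2 MvPolynomial.X_injective
  have hDdeg : (Matrix.vandermonde (X : Fin n → MvPolynomial (Fin n) ℂ)).det.totalDegree =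
      ∑ i : Fin n, ∑ _j ∈ Finset.Ioi i, 1 := by
    refine IsHomogeneous.totalDegree ?_ hD
    rw [Matrix.det_vandermonde]
    exact IsHomogeneous.prod _ _ _ fun i _ => IsHomogeneous.prod _ _ _ fun j _ =>
      (isHomogeneous_X _ _).sub (isHomogeneous_X _ _)
  have hfac : (Nat.factorial (n - lam.length) : MvPolynomial (Fin n) ℂ) ≠ 0 :=
    Nat.cast_ne_zero.2 (Nat.factorial_ne_zero _)
  have h1 := congrArg totalDegree (multPPoly_mul_det a lam n hl)
  rw [totalDegree_mul_of_isDomain (mul_ne_zero hfac hf) hD, totalDegree_mul_of_isDomain hfac hf,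
    hDdeg] at h1
  have h2 : (altNumer a lam (X : Fin n → MvPolynomial (Fin n) ℂ)).totalDegree ≤
      ∑ i ∈ Finset.range lam.length, lam.part i + ∑ i : Fin n, ∑ _j ∈ Finset.Ioi i, 1 := by
    refine totalDegree_finsetSum_le fun ω _ => ?_
    refine (totalDegree_mul _ _).trans ?_
    have hs : (((Equiv.Perm.sign ω : ℤ) : MvPolynomial (Fin n) ℂ)).totalDegree = 0 := by
      rw [← map_intCast (C : ℂ →+* MvPolynomial (Fin n) ℂ), totalDegree_C]
    rw [hs, zero_add, numer]
    refine (totalDegree_mul _ _).trans (add_le_add ?_ ?_)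
    · refine (totalDegree_finsetProd _ _).trans ?_
      refine (Finset.sum_le_sum fun i _ => totalDegree_genPow a (ω i) _).trans ?_
      rw [← Finset.sum_image (s := Finset.univ.filter fun i : Fin n => i.val < lam.length)
        (g := fun i : Fin n => i.val) (f := fun i => lam.part i) (fun i _ j _ h => Fin.ext h)]
      refine Finset.sum_le_sum_of_subset fun i hi => ?_
      simp only [Finset.mem_image, Finset.mem_filter, Finset.mem_univ, true_and] at hi
      obtain ⟨j, hj, rfl⟩ := hi
      simpa using hj
    · refine (totalDegree_finsetProd _ _).trans (Finset.sum_le_sum fun i _ => ?_)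
      refine (totalDegree_finsetProd _ _).trans (Finset.sum_le_sum fun j _ => ?_)
      have hX : ∀ u : Fin n, (X u : MvPolynomial (Fin n) ℂ).totalDegree ≤ 1 :=
        fun u => (totalDegree_X u).le
      split_ifs
      · rw [totalDegree_neg]
        exact (totalDegree_add _ _).trans (max_le (hX _) (hX _))
      · exact (totalDegree_sub _ _).trans (max_le (hX _) (hX _))
  omega

/-! ### The multiparameter Schur P- and Q-functions -/

/-- The multiparameter Schur P-function `P_{λ;a}`, where `a_1 = 0`. -/
noncomputable def multP (a : ℕ → ℂ) (ha : a 1 = 0) (lam : StrictPartition) : Gam :=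
  ⟨fun n => multPPoly a lam n, multPPoly_isSupersymmetric a lam,
    specializeLast_multPPoly a ha lam, _, totalDegree_multPPoly a lam⟩

/-- The multiparameter Schur Q-function `Q_{λ;a} = 2^{ℓ(λ)} P_{λ;a}`. -/
noncomputable def multQ (a : ℕ → ℂ) (ha : a 1 = 0) (lam : StrictPartition) : Gam :=
  2 ^ lam.length * multP a ha lam

/-- `Q_{(k,l);a}` for arbitrary `k, l ≥ 0`: for `k > l` it is the Q-function of the strict partition
`(k, l)`, and `Q_{(k,l);a} = -Q_{(l,k);a}` for `k ≤ l`, so that it is `0` for `k = l`. -/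
noncomputable def multQ₂ (a : ℕ → ℂ) (ha : a 1 = 0) (k l : ℕ) : Gam :=
  if h : l < k then multQ a ha (StrictPartition.ofPair k l h)
  else if h : k < l then -multQ a ha (StrictPartition.ofPair l k h)
  else 0

end SchurQ

namespace SchurQ

/-! ### A rational function identity -/

/-! The Pfaffian formula is Schur's Pfaffian `Pf(K(y_i, y_j)) = ∏_{i<j} K(y_i, y_j)`, with `K(u, v)
= (v - u) / (u + v)`, averaged against product weights.

Members of `Gam` are compared by their values at points `x` with distinct coordinates and all `x_i +
x_j ≠ 0` (`Gam_ext`). At such a point each summand of `P_{λ;a}` splits: let `w_p` be the product of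
`(x_p + x_q) / (x_p - x_q)` over all `q ≠ p`. The product of the `w_{x_i}` over `i ≤ ℓ` counts every
pair inside the first `ℓ` indices twice, and `∏ K(x_i, x_j)` cancels the excess. Hence `Q_{λ;a}` is
a sum over all tuples of indices of `∏_i c_{λ_i}(p_i) * ∏_{i<j} K(x_{p_i}, x_{p_j})`, where `c_k`
depends on one part only (`multPExpr_eq_sum`). For odd `ℓ` the tuple is lengthened by an additional
variable equal to zero, used by the part `0` with coefficient `-1`; this is harmless because `K(u,
0) = -1` (`two_pow_mul_multPExpr_eq_sum_of_even`).

For two parts the same formula reads `Q_{(k,l);a} = ∑ c_k(p) c_l(q) K(x_p, x_q)`, so the matrix of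
the theorem has the form `G K Gᵀ` above the diagonal. Its Pfaffian expands multilinearly
(`pfaffian_sum`), and Schur's Pfaffian (`pfaffian_kernel`) identifies the two sums tuple by tuple.
Schur's Pfaffian itself follows by induction along the first row (`pfaffian_succ`) from a Lagrange
interpolation identity (`sum_prod_add_div_sub_eq_zero`). -/

theorem prod_erase_succAbove {M : Type*} [CommMonoid M] {n : ℕ} (i : Fin (n + 1))
    (f : Fin (n + 1) → M) : ∏ j ∈ Finset.univ.erase i, f j = ∏ k, f (i.succAbove k) := by
  have h : (Finset.univ.erase i : Finset (Fin (n + 1))) = Finset.univ.image i.succAbove := by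
    rw [Fin.image_succAbove_univ, Finset.compl_singleton]
  rw [h, Finset.prod_image fun a _ b _ e => Fin.succAbove_right_injective e]

/-- Interpolate the monic polynomial `∏ (X + z_k)` of degree `n + 1` at the `n + 2` nodes `0, z_0,
..., z_n` and compare leading coefficients. The node `0` contributes `(-1)^(n+1) = 1`, and the node
`z_j` contributes twice the `j`-th summand, since `(z_j + z_j) / (z_j - 0) = 2`. So `1 = 1 + 2 * ∑`.
-/
theorem sum_prod_add_div_sub_eq_zero {F : Type*} [Field F] [CharZero F] {n : ℕ} (hn : Odd n)
    (z : Fin (n + 1) → F) (hz : Function.Injective z) (hz0 : ∀ i, z i ≠ 0) :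
    ∑ j, ∏ k : Fin n, (z j + z (j.succAbove k)) / (z j - z (j.succAbove k)) = 0 := by
  have hv : Function.Injective (Fin.cons (0 : F) z : Fin (n + 2) → F) :=
    Fin.cons_injective_iff.2 ⟨by rintro ⟨i, hi⟩; exact hz0 i hi, hz⟩
  let P : Polynomial F := ∏ k, (Polynomial.X + Polynomial.C (z k))
  have hP : P.Monic := Polynomial.monic_prod_of_monic _ _ fun i _ => Polynomial.monic_X_add_C _
  have hdeg : P.degree = (n + 1 : ℕ) := by
    simp [P, Polynomial.degree_prod]
  have h := Lagrange.leadingCoeff_eq_sum (s := Finset.univ) hv.injOn (P := P)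
    (by rw [hdeg, Finset.card_univ, Fintype.card_fin]; rfl)
  have heval : ∀ t, P.eval t = ∏ k, (t + z k) := fun t => by
    simp [P, Polynomial.eval_prod]
  rw [hP.leadingCoeff, Fin.sum_univ_succ] at h
  simp only [heval, prod_erase_succAbove, Fin.cons_zero, Fin.cons_succ, Fin.zero_succAbove,
    zero_add, zero_sub] at h
  have h0 : (∏ k, z k) / ∏ k, -z k = 1 := by
    rw [Finset.prod_neg, Finset.card_univ, Fintype.card_fin, hn.add_one.neg_one_pow, one_mul]
    exact div_self (Finset.prod_ne_zero_iff.2 fun i _ => hz0 i)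
  have h1 : ∀ j, (∏ k, (z j + z k)) /
      ∏ k, (z j - (Fin.cons (0 : F) z : Fin (n + 2) → F) (j.succ.succAbove k)) =
      2 * ∏ k : Fin n, (z j + z (j.succAbove k)) / (z j - z (j.succAbove k)) := by
    intro j
    rw [Fin.prod_univ_succAbove _ j, Fin.prod_univ_succ]
    simp only [Fin.succ_succAbove_zero, Fin.succ_succAbove_succ, Fin.cons_zero, Fin.cons_succ,
      sub_zero]
    rw [mul_div_mul_comm, ← Finset.prod_div_distrib, ← two_mul, mul_div_cancel_right₀ _ (hz0 j)]
  rw [h0] at h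
  simp only [h1, ← Finset.mul_sum] at h
  simpa using h

/-- The kernel `(v - u) / (u + v)`. -/
def kernel {F : Type*} [Field F] (u v : F) : F := (v - u) / (u + v)

theorem kernel_antisymm {F : Type*} [Field F] (u v : F) : kernel u v = -kernel v u := by
  rw [kernel, kernel, ← neg_div, neg_sub, add_comm]

/-- This is the preceding identity at the points `-t, y_0, ..., y_{2m}`: negating `t` turns the
factors involving it into kernels, and the summand of `-t` is moved to the other side. It supplies
the first-row expansion of Schur's product. -/
theorem prod_kernel_eq_sum {F : Type*} [Field F] [CharZero F] {m : ℕ} (t : F)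
    (y : Fin (2 * m + 1) → F) (hy : Function.Injective y) (ht : t ≠ 0) (hy0 : ∀ i, y i ≠ 0)
    (hty : ∀ i, t + y i ≠ 0) :
    ∏ k, kernel t (y k) =
      ∑ j, kernel t (y j) * ∏ k : Fin (2 * m), (kernel (y j) (y (j.succAbove k)))⁻¹ := by
  have hz : Function.Injective (Fin.cons (-t) y : Fin (2 * m + 2) → F) :=
    Fin.cons_injective_iff.2 ⟨by
      rintro ⟨i, hi⟩
      exact hty i (by rw [hi, add_neg_cancel]), hy⟩
  have h := sum_prod_add_div_sub_eq_zero (n := 2 * m + 1) ⟨m, rfl⟩ _ hz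
    (Fin.cases (by simpa using ht) (by simpa using hy0))
  rw [Fin.sum_univ_succ] at h
  simp only [Fin.prod_univ_succ (n := 2 * m), Fin.succ_succAbove_zero, Fin.succ_succAbove_succ,
    Fin.cons_zero, Fin.cons_succ, Fin.zero_succAbove] at h
  have h1 : ∀ v, (-t + v) / (-t - v) = -kernel t v := fun v => by
    rw [kernel, ← div_neg]
    congr 1 <;> ring
  have h2 : ∀ v, (v + -t) / (v - -t) = kernel t v := fun v => by
    rw [kernel]
    congr 1 <;> ring
  have h3 : ∀ u v : F, (u + v) / (u - v) = -(kernel u v)⁻¹ := fun u v => by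
    rw [kernel, inv_div, ← div_neg, neg_sub]
  have h4 : Even (2 * m) := even_two_mul m
  simp only [h1, h2, h3, Finset.prod_neg, Finset.card_univ, Fintype.card_fin, h4.neg_one_pow,
    one_mul] at h
  rw [Fin.prod_univ_succ]
  linear_combination -h

/-- Moving the index `j` to the front is a cycle of sign `(-1)^j`, and a product of an antisymmetric
function over pairs changes by that sign. -/
theorem prod_Ioi_eq_succAbove {R : Type*} [CommRing R] {n : ℕ} (j : Fin (n + 1))
    {f : Fin (n + 1) → Fin (n + 1) → R} (hf : ∀ i j, f i j = -f j i) :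
    ∏ i, ∏ k ∈ Finset.Ioi i, f i k = (-1) ^ (j : ℕ) * ((∏ k, f j (j.succAbove k)) *
      ∏ i, ∏ k ∈ Finset.Ioi i, f (j.succAbove i) (j.succAbove k)) := by
  have h := Equiv.Perm.prod_Ioi_comp_eq_sign_mul_prod j.cycleRange.symm hf
  rw [Fin.prod_univ_succ, Fin.prod_Ioi_zero] at h
  simp only [Fin.prod_Ioi_succ, Fin.cycleRange_symm_zero, Fin.cycleRange_symm_succ,
    Equiv.Perm.sign_symm, Fin.sign_cycleRange] at h
  rw [h]
  push_cast
  rw [← mul_assoc, ← pow_add, Even.neg_one_pow ⟨_, rfl⟩, one_mul]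

/-! ### Pfaffians -/

theorem pfaffian_congr {R : Type*} [CommRing R] {m : ℕ} {A B : Matrix (Fin (2 * m)) (Fin (2 * m)) R}
    (h : ∀ i j, i < j → A i j = B i j) : pfaffian A = pfaffian B := by
  rw [pfaffian, pfaffian]
  refine Finset.sum_congr rfl fun ω hω => ?_
  congr 1
  exact Finset.prod_congr rfl fun i _ => h _ _ ((Finset.mem_filter.1 hω).2.1 i)

theorem map_pfaffian {R S : Type*} [CommRing R] [CommRing S] (φ : R →+* S) {m : ℕ}
    (A : Matrix (Fin (2 * m)) (Fin (2 * m)) R) : φ (pfaffian A) = pfaffian (A.map φ) := by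
  simp [pfaffian, map_sum, map_mul, map_prod]

theorem double_bijective (m : ℕ) : Function.Bijective
    (Sum.elim (fun i : Fin m => (⟨2 * i.val, by omega⟩ : Fin (2 * m)))
      (fun i : Fin m => ⟨2 * i.val + 1, by omega⟩)) := by
  constructor
  · rintro (i | i) (j | j) h <;> simp only [Sum.elim_inl, Sum.elim_inr, Fin.mk.injEq] at h
    · rw [Fin.ext (by omega : i.val = j.val)]
    · omega
    · omega
    · rw [Fin.ext (by omega : i.val = j.val)]
  · intro k
    rcases Nat.even_or_odd' k.val with ⟨c, hc | hc⟩
    · exact ⟨Sum.inl ⟨c, by omega⟩, Fin.ext hc.symm⟩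
    · exact ⟨Sum.inr ⟨c, by omega⟩, Fin.ext hc.symm⟩

/-- The positions `0, ..., 2m - 1` split into even and odd ones. -/
noncomputable def double (m : ℕ) : Fin m ⊕ Fin m ≃ Fin (2 * m) :=
  Equiv.ofBijective _ (double_bijective m)

/-- Multilinear expansion of the Pfaffian of a matrix `G K Gᵀ`. -/
theorem pfaffian_sum {R ι : Type*} [CommRing R] [Fintype ι] {m : ℕ}
    (g : Fin (2 * m) → ι → R) (K : ι → ι → R) :
    pfaffian (Matrix.of fun i j => ∑ p, ∑ q, g i p * g j q * K p q) =
      ∑ r : Fin (2 * m) → ι, (∏ i, g i (r i)) * pfaffian (Matrix.of fun i j => K (r i) (r j)) := by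
  classical
  simp only [pfaffian, Finset.mul_sum]
  rw [Finset.sum_comm]
  refine Finset.sum_congr rfl fun ω _ => ?_
  have h1 : ∀ r : Fin (2 * m) → ι, ∏ i, g i (r i) = ∏ i : Fin m,
      g (ω ⟨2 * i, by omega⟩) (r (ω ⟨2 * i, by omega⟩)) *
        g (ω ⟨2 * i + 1, by omega⟩) (r (ω ⟨2 * i + 1, by omega⟩)) := by
    intro r
    rw [← Equiv.prod_comp ω, ← (double m).prod_comp, Fintype.prod_sum_type, Finset.prod_mul_distrib]
    rfl
  simp only [h1, mul_left_comm _ ((Equiv.Perm.sign ω : ℤ) : R), ← Finset.mul_sum, Matrix.of_apply,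
    ← Finset.prod_mul_distrib]
  congr 1
  -- An index for each of the `2m` positions is the same as a pair of indices for each of the `m`
  -- pairs matched by `ω`.
  let E : (Fin (2 * m) → ι) ≃ (Fin m → ι × ι) :=
    (((double m).trans ω).arrowCongr (Equiv.refl ι)).symm.trans
      ((Equiv.sumArrowEquivProdArrow _ _ _).trans (Equiv.arrowProdEquivProdArrow _ _ _).symm)
  have h2 : ∀ i : Fin m, ∑ p, ∑ q,
      g (ω ⟨2 * i, by omega⟩) p * g (ω ⟨2 * i + 1, by omega⟩) q * K p q =
        ∑ c : ι × ι, g (ω ⟨2 * i, by omega⟩) c.1 * g (ω ⟨2 * i + 1, by omega⟩) c.2 * K c.1 c.2 :=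
    fun i => (Fintype.sum_prod_type' _).symm
  rw [Finset.prod_congr rfl fun i _ => h2 i, Fintype.prod_sum]
  exact (Fintype.sum_equiv E _ _ fun r => rfl).symm

/-- The permutation with `0 ↦ 0`, `1 ↦ j + 1` whose remaining values are ordered as prescribed
by `σ`. -/
def prependPair {n : ℕ} (j : Fin (n + 1)) (σ : Equiv.Perm (Fin n)) : Equiv.Perm (Fin (n + 2)) :=
  Equiv.Perm.decomposeFin.symm (0, j.cycleRange.symm * Equiv.Perm.decomposeFin.symm (0, σ))

section prependPair

variable {n : ℕ} (j : Fin (n + 1)) (σ : Equiv.Perm (Fin n))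

theorem prependPair_zero : prependPair j σ 0 = 0 := by
  simp [prependPair]

theorem prependPair_one : prependPair j σ 1 = j.succ := by
  rw [← Fin.succ_zero_eq_one, prependPair, Equiv.Perm.decomposeFin_symm_apply_succ]
  simp

theorem prependPair_succ_succ (i : Fin n) :
    prependPair j σ i.succ.succ = (j.succAbove (σ i)).succ := by
  simp [prependPair, Equiv.Perm.decomposeFin_symm_apply_succ]

theorem sign_prependPair :
    Equiv.Perm.sign (prependPair j σ) = (-1) ^ (j : ℕ) * Equiv.Perm.sign σ := by
  simp [prependPair]

theorem prependPair_injective :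
    Function.Injective fun c : Fin (n + 1) × Equiv.Perm (Fin n) => prependPair c.1 c.2 := by
  rintro ⟨j, σ⟩ ⟨k, τ⟩ h
  simp only [prependPair, EmbeddingLike.apply_eq_iff_eq, Prod.mk.injEq, true_and] at h
  have h0 := DFunLike.congr_fun h 0
  simp only [Equiv.Perm.coe_mul, Function.comp_apply, Equiv.Perm.decomposeFin_symm_apply_zero,
    Fin.cycleRange_symm_zero] at h0
  subst h0
  have h1 := Equiv.Perm.decomposeFin.symm.injective (mul_left_cancel h)
  simpa using h1

theorem exists_prependPair (ω : Equiv.Perm (Fin (n + 2))) (h : ω 0 = 0) :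
    ∃ j σ, prependPair j σ = ω := by
  have key : ∀ {k : ℕ} (ρ : Equiv.Perm (Fin (k + 1))), ρ 0 = 0 →
      ∃ τ, Equiv.Perm.decomposeFin.symm (0, τ) = ρ := by
    intro k ρ hρ
    refine ⟨(Equiv.Perm.decomposeFin ρ).2, ?_⟩
    have h1 : (Equiv.Perm.decomposeFin ρ).1 = 0 := by
      have h2 := Equiv.Perm.decomposeFin_symm_apply_zero (Equiv.Perm.decomposeFin ρ).1
        (Equiv.Perm.decomposeFin ρ).2
      rw [Prod.mk.eta, Equiv.symm_apply_apply, hρ] at h2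
      exact h2.symm
    rw [← h1, Prod.mk.eta, Equiv.symm_apply_apply]
  obtain ⟨τ, rfl⟩ := key ω h
  -- The cycle brings `τ 0` back to `0`, so the composite fixes `0` and `key` applies a second time.
  obtain ⟨σ, hσ⟩ := key ((τ 0).cycleRange * τ) (by simp)
  exact ⟨τ 0, σ, by rw [prependPair, hσ]; congr 2; ext; simp⟩

end prependPair

/-- Expansion of the Pfaffian along the first row. -/
theorem pfaffian_succ {R : Type*} [CommRing R] {m : ℕ}
    (A : Matrix (Fin (2 * m + 2)) (Fin (2 * m + 2)) R) :
    pfaffian (m := m + 1) A = ∑ j : Fin (2 * m + 1), (-1) ^ (j : ℕ) * (A 0 j.succ *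
      pfaffian (A.submatrix (fun i => (j.succAbove i).succ) (fun i => (j.succAbove i).succ))) := by
  have hev : ∀ (j : Fin (2 * m + 1)) (σ : Equiv.Perm (Fin (2 * m))) (i : Fin m),
      prependPair j σ ⟨2 * (i.succ : ℕ), by rw [Fin.val_succ]; omega⟩ =
        (j.succAbove (σ ⟨2 * i, by omega⟩)).succ := fun j σ i => by
    rw [← prependPair_succ_succ]
    rfl
  have hod : ∀ (j : Fin (2 * m + 1)) (σ : Equiv.Perm (Fin (2 * m))) (i : Fin m),
      prependPair j σ ⟨2 * (i.succ : ℕ) + 1, by rw [Fin.val_succ]; omega⟩ =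
        (j.succAbove (σ ⟨2 * i + 1, by omega⟩)).succ := fun j σ i => by
    rw [← prependPair_succ_succ]
    rfl
  have hlt : ∀ (j : Fin (2 * m + 1)) (u v : Fin (2 * m)),
      (j.succAbove u).succ < (j.succAbove v).succ ↔ u < v := fun j u v => by
    rw [Fin.succ_lt_succ_iff, (Fin.strictMono_succAbove j).lt_iff_lt]
  simp only [pfaffian, Finset.mul_sum]
  rw [← Finset.sum_product']
  symm
  refine Finset.sum_nbij (fun c => prependPair c.1 c.2) ?_ (prependPair_injective.injOn) ?_ ?_
  · rintro ⟨j, σ⟩ hσ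
    simp only [Finset.mem_product, Finset.mem_univ, true_and, Finset.mem_filter] at hσ ⊢
    refine ⟨fun i => ?_, fun i k hik => ?_⟩
    · refine Fin.cases ?_ (fun i => ?_) i
      · exact (prependPair_zero j σ).trans_lt
          ((Fin.succ_pos j).trans_eq (prependPair_one j σ).symm)
      · rw [hev j σ i, hod j σ i, hlt]
        exact hσ.1 i
    · obtain ⟨k, rfl⟩ := Fin.exists_succ_eq_of_ne_zero (Fin.ne_zero_of_lt hik)
      rw [hev j σ k]
      revert hik
      refine Fin.cases ?_ (fun i => ?_) i
      · intro _
        exact (prependPair_zero j σ).trans_lt (Fin.succ_pos _)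
      · intro hik
        rw [hev j σ i, hlt]
        exact hσ.2 i k (Fin.succ_lt_succ_iff.1 hik)
  · intro ω hω
    simp only [Finset.coe_filter, Finset.mem_univ, true_and, Set.mem_ofPred_eq] at hω
    -- The value `0` can be neither the second entry of a pair nor the first entry of a later pair,
    -- because something smaller would have to precede it.
    have h0 : ω 0 = 0 := by
      by_contra hne
      obtain ⟨c, hc⟩ := (double (m + 1)).surjective (ω.symm 0)
      have hc' : ω (double (m + 1) c) = 0 := by rw [hc, Equiv.apply_symm_apply]
      rcases c with i | i
      · change ω ⟨2 * i, _⟩ = 0 at hc'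
        rcases eq_or_ne i 0 with rfl | hi
        · exact hne hc'
        · exact absurd (hω.2 0 i (Fin.pos_of_ne_zero hi)) (by rw [hc']; exact Fin.not_lt_zero _)
      · change ω ⟨2 * i + 1, _⟩ = 0 at hc'
        exact absurd (hω.1 i) (by rw [hc']; exact Fin.not_lt_zero _)
    obtain ⟨j, σ, rfl⟩ := exists_prependPair ω h0
    refine ⟨(j, σ), ?_, rfl⟩
    simp only [Finset.coe_product, Finset.coe_univ, Set.mem_prod, Set.mem_univ, true_and,
      Finset.coe_filter, Finset.mem_univ, Set.mem_ofPred_eq]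
    refine ⟨fun i => ?_, fun i k hik => ?_⟩
    · have h := hω.1 i.succ
      rwa [hev j σ i, hod j σ i, hlt] at h
    · have h := hω.2 i.succ k.succ (Fin.succ_lt_succ_iff.2 hik)
      rwa [hev j σ i, hev j σ k, hlt] at h
  · rintro ⟨j, σ⟩ _
    rw [Fin.prod_univ_succ]
    have e0 : prependPair j σ ⟨2 * (0 : Fin (m + 1)).val, by simp⟩ = 0 := prependPair_zero j σ
    have e1 : prependPair j σ ⟨2 * (0 : Fin (m + 1)).val + 1, by simp⟩ = j.succ :=
      prependPair_one j σ
    rw [e0, e1, sign_prependPair]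
    simp only [hev j σ, hod j σ, Matrix.submatrix_apply]
    push_cast
    ring

/-! ### Schur's Pfaffian -/

theorem prod_univ_Ioi_succ {M : Type*} [CommMonoid M] {n : ℕ} (f : Fin (n + 1) → Fin (n + 1) → M) :
    ∏ i, ∏ j ∈ Finset.Ioi i, f i j =
      (∏ k : Fin n, f 0 k.succ) * ∏ i : Fin n, ∏ j ∈ Finset.Ioi i, f i.succ j.succ := by
  rw [Fin.prod_univ_succ, Fin.prod_Ioi_zero]
  simp only [Fin.prod_Ioi_succ]

/-- Induction on `m`: both sides are expanded over the partner `j` of the first index, the left by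
`pfaffian_succ` and the right by `prod_kernel_eq_sum`. -/
theorem pfaffian_kernel_of_injective {F : Type*} [Field F] [CharZero F] {m : ℕ}
    (y : Fin (2 * m) → F) (hy : Function.Injective y) (hy0 : ∀ i j, y i + y j ≠ 0) :
    pfaffian (Matrix.of fun i j => kernel (y i) (y j)) =
      ∏ i, ∏ j ∈ Finset.Ioi i, kernel (y i) (y j) := by
  induction m with
  | zero => simp [pfaffian]
  | succ m ih =>
    change Fin (2 * m + 2) → F at y
    have hne : ∀ i, y i ≠ 0 := fun i h => hy0 i i (by rw [h, add_zero])
    have hker : ∀ i j, i ≠ j → kernel (y i) (y j) ≠ 0 := fun i j hij =>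
      div_ne_zero (sub_ne_zero.2 fun e => hij (hy e).symm) (hy0 i j)
    have hsucc : Function.Injective fun i : Fin (2 * m + 1) => y i.succ :=
      fun i j e => Fin.succ_injective _ (hy e)
    refine (pfaffian_succ (m := m) _).trans ?_
    refine Eq.trans ?_ (prod_univ_Ioi_succ fun i j => kernel (y i) (y j)).symm
    rw [prod_kernel_eq_sum (y 0) (fun i : Fin (2 * m + 1) => y i.succ) hsucc (hne 0)
      (fun i => hne _) (fun i => hy0 _ _), Finset.sum_mul]
    refine Finset.sum_congr rfl fun j _ => ?_
    have h1 := ih (fun i => y (j.succAbove i).succ)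
      (fun a b e => Fin.succAbove_right_injective (hsucc e)) (fun a b => hy0 _ _)
    have h2 := prod_Ioi_eq_succAbove j (f := fun i k : Fin (2 * m + 1) => kernel (y i.succ) (y k.succ))
      (fun i k => kernel_antisymm _ _)
    have h3 : ∏ k, kernel (y j.succ) (y (j.succAbove k).succ) ≠ 0 :=
      Finset.prod_ne_zero_iff.2 fun k _ => hker _ _ fun e =>
        Fin.succAbove_ne j k (Fin.succ_injective _ e).symm
    -- Pulling the row of `j` out of the product over the remaining indices gives the sign `(-1)^j`
    -- and exactly the factors cancelled by the inverses; what is left is the product for the minor.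
    rw [h2, Finset.prod_inv_distrib]
    change _ * (_ * pfaffian (Matrix.of fun i k =>
      kernel (y (j.succAbove i).succ) (y (j.succAbove k).succ))) = _
    rw [h1]
    simp only [Matrix.of_apply]
    field_simp

open Filter Topology in
-- Tuples with repeated values, or with one value zero, occur in the expansion of the Pfaffian. They
-- are limits of the generic case, and no diagonal entry enters, so both sides are continuous there.
theorem pfaffian_kernel {m : ℕ} (y : Fin (2 * m) → ℂ) (hy0 : ∀ i j, i ≠ j → y i + y j ≠ 0) :
    pfaffian (Matrix.of fun i j => kernel (y i) (y j)) =
      ∏ i, ∏ j ∈ Finset.Ioi i, kernel (y i) (y j) := by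
  -- The slopes `i + 1` are distinct and have non-zero pairwise sums (a slope `0` would fail for `z
  -- s i + z s i`), so for small `s ≠ 0` the point is generic.
  let z : ℂ → Fin (2 * m) → ℂ := fun s i => y i + s * ((i : ℕ) + 1 : ℕ)
  have hz0 : ∀ i, z 0 i = y i := fun i => by simp [z]
  have hz : ∀ i, Continuous fun s => z s i := fun i => by fun_prop
  have hker : ∀ i j, i ≠ j → ContinuousAt (fun s => kernel (z s i) (z s j)) 0 := by
    intro i j hij
    refine ContinuousAt.div ((hz j).sub (hz i)).continuousAt ((hz i).add (hz j)).continuousAt ?_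
    simpa only [hz0] using hy0 i j hij
  have hpf : ContinuousAt
      (fun s => pfaffian (Matrix.of fun i j => kernel (z s i) (z s j))) 0 := by
    refine tendsto_finsetSum _ fun ω hω => ?_
    refine tendsto_const_nhds.mul (tendsto_finsetProd _ fun i _ => ?_)
    exact hker _ _ ((Finset.mem_filter.1 hω).2.1 i).ne
  have hpr : ContinuousAt (fun s => ∏ i, ∏ j ∈ Finset.Ioi i, kernel (z s i) (z s j)) 0 :=
    tendsto_finsetProd _ fun i _ => tendsto_finsetProd _ fun j hj =>
      hker _ _ (Finset.mem_Ioi.1 hj).ne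
  have hlin : ∀ u v : ℂ, v ≠ 0 → ∀ᶠ s in 𝓝[≠] (0 : ℂ), u + s * v ≠ 0 := by
    intro u v hv
    by_cases hu : u = 0
    · filter_upwards [self_mem_nhdsWithin] with s hs
      simpa [hu, hv] using hs
    · refine nhdsWithin_le_nhds (ContinuousAt.eventually_ne (by fun_prop) ?_)
      simpa using hu
  have hinj : ∀ᶠ s in 𝓝[≠] (0 : ℂ), Function.Injective (z s) := by
    have : ∀ᶠ s in 𝓝[≠] (0 : ℂ), ∀ i j, i ≠ j → z s i ≠ z s j := by
      refine eventually_all.2 fun i => eventually_all.2 fun j => ?_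
      by_cases hij : i = j
      · exact Eventually.of_forall fun s h => absurd hij h
      have hv : (((i : ℕ) + 1 : ℕ) : ℂ) - ((j : ℕ) + 1 : ℕ) ≠ 0 := by
        rw [sub_ne_zero, ne_eq, Nat.cast_inj]
        omega
      filter_upwards [hlin (y i - y j) _ hv] with s hs _ e
      apply hs
      simp only [z] at e
      linear_combination e
    filter_upwards [this] with s hs i j e
    by_contra hij
    exact hs i j hij e
  have hadd : ∀ᶠ s in 𝓝[≠] (0 : ℂ), ∀ i j, z s i + z s j ≠ 0 := by
    refine eventually_all.2 fun i => eventually_all.2 fun j => ?_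
    have hv : (((i : ℕ) + 1 : ℕ) : ℂ) + ((j : ℕ) + 1 : ℕ) ≠ 0 := by
      rw [← Nat.cast_add, Nat.cast_ne_zero]
      omega
    filter_upwards [hlin (y i + y j) _ hv] with s hs e
    apply hs
    simp only [z] at e
    linear_combination e
  have heq : (fun s => pfaffian (Matrix.of fun i j => kernel (z s i) (z s j))) =ᶠ[𝓝[≠] 0]
      fun s => ∏ i, ∏ j ∈ Finset.Ioi i, kernel (z s i) (z s j) := by
    filter_upwards [hinj, hadd] with s h1 h2
    exact pfaffian_kernel_of_injective _ h1 h2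
  have h := tendsto_nhds_unique ((hpf.tendsto.mono_left nhdsWithin_le_nhds).congr' heq)
    (hpr.tendsto.mono_left nhdsWithin_le_nhds)
  simpa only [hz0] using h

/-! ### Sums over permutations and sums over tuples -/

/-- The permutations carrying `c` to `q` form a coset, through one such `ω₀`, of the group of
permutations fixing the range of `c` pointwise. -/
theorem card_perm_comp_eq {α β : Type*} [Fintype α] [DecidableEq α] [Fintype β] (c q : β → α)
    (hc : Function.Injective c) (hq : Function.Injective q) :
    Nat.card {ω : Equiv.Perm α // ω ∘ c = q} =
      (Fintype.card α - Fintype.card β).factorial := by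
  classical
  let ω₀ : Equiv.Perm α :=
    ((Equiv.ofInjective c hc).symm.trans (Equiv.ofInjective q hq)).extendSubtype
  have hω₀ : ∀ b, ω₀ (c b) = q b := by
    intro b
    have h := Equiv.extendSubtype_apply_of_mem
      ((Equiv.ofInjective c hc).symm.trans (Equiv.ofInjective q hq)) (c b) ⟨b, rfl⟩
    refine h.trans ?_
    have : (⟨c b, ⟨b, rfl⟩⟩ : Set.range c) = Equiv.ofInjective c hc b := rfl
    rw [Equiv.trans_apply, this, Equiv.symm_apply_apply]
    rfl
  let e : {ω : Equiv.Perm α // ω ∘ c = q} ≃ Equiv.Perm {a // a ∉ Set.range c} :=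
    ((Equiv.mulLeft ω₀⁻¹).subtypeEquiv fun ω => by
      constructor
      · rintro rfl a ha
        obtain ⟨b, rfl⟩ := not_not.1 ha
        exact ω₀.symm_apply_eq.2 (hω₀ b).symm
      · intro h
        funext b
        exact (ω₀.symm_apply_eq.1 (h (c b) (not_not.2 ⟨b, rfl⟩))).trans (hω₀ b)).trans
      (Equiv.Perm.subtypeEquivSubtypePerm fun a => a ∉ Set.range c).symm
  rw [Nat.card_congr e, Nat.card_eq_fintype_card, Fintype.card_perm, Fintype.card_subtype_compl]
  congr 2
  exact (Fintype.card_congr (Equiv.ofInjective c hc)).symm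

/-- The factorial is the size of each fibre of `ω ↦ ω ∘ c` over an injective tuple; it cancels the
factor `1 / (n - ℓ)!` in the P-polynomial. -/
theorem sum_perm_comp {R α β : Type*} [CommRing R] [Fintype α] [DecidableEq α] [Fintype β]
    [DecidableEq β] (c : β → α) (hc : Function.Injective c) (f : (β → α) → R)
    (hf : ∀ q, ¬Function.Injective q → f q = 0) :
    ∑ ω : Equiv.Perm α, f (ω ∘ c) =
      ((Fintype.card α - Fintype.card β).factorial : R) * ∑ q, f q := by
  classical
  rw [← Finset.sum_fiberwise Finset.univ (fun ω : Equiv.Perm α => (ω : α → α) ∘ c),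
    Finset.mul_sum]
  refine Finset.sum_congr rfl fun q _ => ?_
  rw [Finset.sum_congr rfl fun ω hω => by rw [(Finset.mem_filter.1 hω).2], Finset.sum_const,
    nsmul_eq_mul]
  by_cases hq : Function.Injective q
  · rw [← card_perm_comp_eq c q hc hq, Nat.card_eq_fintype_card, Fintype.card_subtype]
  · rw [hf q hq, mul_zero, mul_zero]

/-! ### The P-polynomials as sums over tuples of indices -/

theorem prod_castLE {M : Type*} [CommMonoid M] {l n : ℕ} (h : l ≤ n) (f : Fin n → M) :
    ∏ i : Fin n with i.val < l, f i = ∏ i : Fin l, f (i.castLE h) := by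
  symm
  refine Finset.prod_nbij (Fin.castLE h) (fun i _ => by simp)
    ((Fin.castLE_injective h).injOn) (fun i hi => ?_) fun _ _ => rfl
  simp only [Finset.coe_filter, Finset.mem_univ, true_and, Set.mem_ofPred_eq] at hi
  exact ⟨⟨i, hi⟩, by simp, rfl⟩

/-- The product of `(x_p + x_q) / (x_p - x_q)` over all `q ≠ p`. -/
def weight {F : Type*} [Field F] {n : ℕ} (x : Fin n → F) (p : Fin n) : F :=
  ∏ q ∈ Finset.univ.erase p, (x p + x q) / (x p - x q)

theorem weight_perm {F : Type*} [Field F] {n : ℕ} (x : Fin n → F) (ω : Equiv.Perm (Fin n))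
    (p : Fin n) : weight (fun i => x (ω i)) p = weight x (ω p) :=
  Finset.prod_equiv ω (by simp) fun _ _ => rfl

/-- For `j < i` among the first `ℓ` indices, the factor of the weight of `x_i` at `x_j` is the
inverse of `kernel (x_j) (x_i)`; only the factors with larger second index survive. -/
theorem summand_eq_prod_weight {F : Type*} [Field F] [Algebra ℂ F] (a : ℕ → ℂ)
    (lam : StrictPartition) {n : ℕ} (hl : lam.length ≤ n) (x : Fin n → F)
    (hx : Function.Injective x) (hx0 : ∀ i j, x i + x j ≠ 0) :
    summand a lam x =
      (∏ i : Fin lam.length, genPow a (x (i.castLE hl)) (lam.part i) * weight x (i.castLE hl)) *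
        ∏ i : Fin lam.length, ∏ j ∈ Finset.Ioi i, kernel (x (i.castLE hl)) (x (j.castLE hl)) := by
  rw [summand, prod_castLE hl, prod_castLE hl, Finset.prod_mul_distrib, mul_assoc]
  congr 1
  have h1 : ∀ i : Fin lam.length, weight x (i.castLE hl) =
      (∏ j ∈ Finset.Ioi (i.castLE hl), (x (i.castLE hl) + x j) / (x (i.castLE hl) - x j)) *
      ∏ j ∈ Finset.Iio i,
        (x (i.castLE hl) + x (j.castLE hl)) / (x (i.castLE hl) - x (j.castLE hl)) := by
    intro i
    rw [← Fin.prod_Iio_castLE hl (fun j => (x (i.castLE hl) + x j) / (x (i.castLE hl) - x j)) i, weight,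
      ← Finset.prod_union (Finset.disjoint_left.2 fun j h1 h2 =>
        lt_asymm (Finset.mem_Ioi.1 h1) (Finset.mem_Iio.1 h2))]
    congr 1
    ext j
    simp [lt_or_lt_iff_ne, ne_comm]
  have h2 : ∏ i : Fin lam.length, ∏ j ∈ Finset.Ioi i,
      kernel (x (i.castLE hl)) (x (j.castLE hl)) = ∏ i : Fin lam.length, ∏ j ∈ Finset.Iio i,
        kernel (x (j.castLE hl)) (x (i.castLE hl)) := Finset.prod_comm' (by simp)
  rw [h2, Finset.prod_congr rfl fun i _ => h1 i, Finset.prod_mul_distrib, mul_assoc,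
    ← Finset.prod_mul_distrib]
  refine (mul_one _).symm.trans (congrArg _ (Eq.symm ?_))
  refine Finset.prod_eq_one fun i _ => ?_
  rw [← Finset.prod_mul_distrib]
  refine Finset.prod_eq_one fun j hj => ?_
  have hne : x (i.castLE hl) - x (j.castLE hl) ≠ 0 := sub_ne_zero.2 fun e =>
    (Finset.mem_Iio.1 hj).ne' (Fin.castLE_injective hl (hx e))
  rw [kernel, add_comm (x (j.castLE hl)), div_mul_div_cancel₀ hne, div_self (hx0 _ _)]

theorem prod_kernel_eq_zero {F : Type*} [Field F] {l : ℕ} (y : Fin l → F)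
    (hy : ¬Function.Injective y) : ∏ i, ∏ j ∈ Finset.Ioi i, kernel (y i) (y j) = 0 := by
  obtain ⟨i, j, hij, hne⟩ : ∃ i j, y i = y j ∧ i ≠ j := by
    simpa [Function.Injective] using hy
  wlog h : i < j generalizing i j
  · exact this j i hij.symm hne.symm (lt_of_le_of_ne (not_lt.1 h) hne.symm)
  refine Finset.prod_eq_zero (Finset.mem_univ i) (Finset.prod_eq_zero (Finset.mem_Ioi.2 h) ?_)
  rw [kernel, hij, sub_self, zero_div]

/-- The kernel product vanishes on tuples with a repetition, so the sum may run over all tuples. For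
`ℓ > n` every tuple has a repetition, which agrees with the value `0` there. -/
theorem multPExpr_eq_sum {F : Type*} [Field F] [Algebra ℂ F] (a : ℕ → ℂ)
    (lam : StrictPartition) {n : ℕ} (x : Fin n → F)
    (hx : Function.Injective x) (hx0 : ∀ i j, x i + x j ≠ 0) :
    multPExpr a lam x = ∑ q : Fin lam.length → Fin n,
      (∏ i, genPow a (x (q i)) (lam.part i) * weight x (q i)) *
        ∏ i, ∏ j ∈ Finset.Ioi i, kernel (x (q i)) (x (q j)) := by
  have : CharZero F := charZero_of_injective_algebraMap (algebraMap ℂ F).injective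
  have h0 : ∀ q : Fin lam.length → Fin n, ¬Function.Injective q →
      (∏ i, genPow a (x (q i)) (lam.part i) * weight x (q i)) *
        ∏ i, ∏ j ∈ Finset.Ioi i, kernel (x (q i)) (x (q j)) = 0 := fun q hq => by
    rw [prod_kernel_eq_zero (fun i => x (q i)) fun h => hq (Function.Injective.of_comp h), mul_zero]
  rw [multPExpr]
  split_ifs with hl
  · have h1 := sum_perm_comp (Fin.castLE hl) (Fin.castLE_injective hl) _ h0
    rw [Fintype.card_fin, Fintype.card_fin] at h1
    rw [inv_mul_eq_iff_eq_mul₀ (Nat.cast_ne_zero.2 (Nat.factorial_ne_zero _))]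
    refine Eq.trans ?_ h1
    refine Finset.sum_congr rfl fun ω _ => ?_
    rw [summand_eq_prod_weight a lam hl (fun i => x (ω i)) (hx.comp ω.injective) fun i j => hx0 _ _]
    simp only [weight_perm, Function.comp_apply]
  · refine (Finset.sum_eq_zero fun q _ => h0 q fun hq => hl ?_).symm
    simpa using Fintype.card_le_of_injective q hq

/-! ### Tuples of even length: an additional variable equal to zero -/

/-- The variables together with an additional variable equal to zero. -/
def extVar {F : Type*} [Field F] {n : ℕ} (x : Fin n → F) (o : Option (Fin n)) : F := o.elim 0 x

/-- The coefficients of the expansion of `Q_{λ;a}` in products of `kernel`. -/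
def coef {F : Type*} [Field F] [Algebra ℂ F] (a : ℕ → ℂ) {n : ℕ} (x : Fin n → F) (k : ℕ)
    (o : Option (Fin n)) : F :=
  if k = 0 then o.elim (-1) 0 else o.elim 0 fun p => 2 * (genPow a (x p) k * weight x p)

theorem sum_option_of_none_eq_zero {R α β : Type*} [CommRing R] [Fintype α] [DecidableEq α]
    [Fintype β] (c : α → Option β → R) (hc : ∀ i, c i none = 0) (G : (α → Option β) → R) :
    ∑ p : α → Option β, (∏ i, c i (p i)) * G p =
      ∑ q : α → β, (∏ i, c i (some (q i))) * G fun i => some (q i) := by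
  symm
  refine Finset.sum_of_injOn (fun q i => some (q i)) ?_ (by simp) ?_ fun _ _ => rfl
  · intro q _ r _ h
    funext i
    exact Option.some_injective _ (congrFun h i)
  · intro p _ hp
    obtain ⟨i, hi⟩ : ∃ i, p i = none := by
      by_contra! h
      refine hp ⟨fun i => (p i).get (Option.isSome_iff_ne_none.2 (h i)), by simp, ?_⟩
      funext i
      exact Option.some_get _
    rw [Finset.prod_eq_zero (Finset.mem_univ i) (by rw [hi, hc]), zero_mul]

theorem two_pow_mul_multPExpr_eq_sum {F : Type*} [Field F] [Algebra ℂ F] (a : ℕ → ℂ)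
    (lam : StrictPartition) {n : ℕ} (x : Fin n → F) (hx : Function.Injective x)
    (hx0 : ∀ i j, x i + x j ≠ 0) :
    2 ^ lam.length * multPExpr a lam x = ∑ p : Fin lam.length → Option (Fin n),
      (∏ i : Fin lam.length, coef a x (lam.part i) (p i)) *
        ∏ i, ∏ j ∈ Finset.Ioi i, kernel (extVar x (p i)) (extVar x (p j)) := by
  have hpart : ∀ i : Fin lam.length, lam.part i ≠ 0 := fun i => (lam.part_pos i i.isLt).ne'
  rw [sum_option_of_none_eq_zero (fun (i : Fin lam.length) => coef a x (lam.part i))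
    (fun i => by rw [coef, if_neg (hpart i)]; rfl), multPExpr_eq_sum a lam x hx hx0,
    Finset.mul_sum]
  refine Finset.sum_congr rfl fun q _ => ?_
  rw [← mul_assoc]
  congr 1
  simp only [coef, if_neg (hpart _), Option.elim_some]
  simp [Finset.prod_mul_distrib]

theorem prod_univ_Ioi_castSucc {M : Type*} [CommMonoid M] {n : ℕ}
    (f : Fin (n + 1) → Fin (n + 1) → M) :
    ∏ i, ∏ j ∈ Finset.Ioi i, f i j = (∏ i : Fin n, ∏ j ∈ Finset.Ioi i, f i.castSucc j.castSucc) *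
      ∏ i : Fin n, f i.castSucc (Fin.last n) := by
  simp only [← Finset.filter_lt_eq_Ioi, Finset.prod_filter]
  rw [Fin.prod_univ_castSucc, ← Finset.prod_mul_distrib]
  simp [Fin.prod_univ_castSucc, Fin.castSucc_lt_last, (Fin.castSucc_lt_last _).not_gt]

/-- If `N = ℓ + 1`, then `ℓ` is odd and the last entry of the tuple must be `none`, with coefficient
`-1`. It adds `ℓ` kernels `kernel u 0 = -1`, whose product is again `-1`, so the sum does not
change. -/
theorem two_pow_mul_multPExpr_eq_sum_of_even {F : Type*} [Field F] [Algebra ℂ F] (a : ℕ → ℂ)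
    (lam : StrictPartition) {n : ℕ} (x : Fin n → F) (hx : Function.Injective x)
    (hx0 : ∀ i j, x i + x j ≠ 0) {N : ℕ} (hN : N = lam.length ∨ N = lam.length + 1)
    (hN' : Even N) :
    2 ^ lam.length * multPExpr a lam x = ∑ p : Fin N → Option (Fin n),
      (∏ i : Fin N, coef a x (lam.part i) (p i)) *
        ∏ i, ∏ j ∈ Finset.Ioi i, kernel (extVar x (p i)) (extVar x (p j)) := by
  rw [two_pow_mul_multPExpr_eq_sum a lam x hx hx0]
  rcases hN with rfl | rfl
  · rfl
  have hpart : ∀ i : Fin lam.length, lam.part i ≠ 0 := fun i => (lam.part_pos i i.isLt).ne'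
  have hlast : lam.part lam.length = 0 := List.getD_eq_default _ _ le_rfl
  have hodd : Odd lam.length := by
    rcases Nat.even_or_odd lam.length with h | h
    · exact absurd hN' (Nat.not_even_iff_odd.2 h.add_one)
    · exact h
  rw [← (Fin.snocEquiv fun _ => Option (Fin n)).sum_comp, Fintype.sum_prod_type,
    Fintype.sum_option, Finset.sum_eq_zero (s := Finset.univ (α := Fin n)), add_zero]
  · refine Finset.sum_congr rfl fun p _ => ?_
    rw [Fin.prod_univ_castSucc, prod_univ_Ioi_castSucc]
    simp only [Fin.snocEquiv_apply, Fin.snoc_castSucc, Fin.snoc_last, Fin.val_castSucc,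
      Fin.val_last, hlast]
    by_cases hp : ∀ i, p i ≠ none
    · have h1 : ∀ i, kernel (extVar x (p i)) (extVar x none) = -1 := by
        intro i
        obtain ⟨q, hq⟩ := Option.ne_none_iff_exists'.1 (hp i)
        have hne : x q ≠ 0 := fun h => hx0 q q (by rw [h, add_zero])
        rw [hq, kernel]
        simp only [extVar, Option.elim_some, Option.elim_none, zero_sub, add_zero]
        rw [neg_div, div_self hne]
      simp only [h1, Finset.prod_const, Finset.card_univ, Fintype.card_fin, hodd.neg_one_pow, coef,
        if_true, Option.elim_none]
      ring
    · push Not at hp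
      obtain ⟨i, hi⟩ := hp
      have h0 : ∏ i : Fin lam.length, coef a x (lam.part i) (p i) = 0 :=
        Finset.prod_eq_zero (Finset.mem_univ i) (by rw [hi, coef, if_neg (hpart i)]; rfl)
      rw [h0]
      ring
  · intro q _
    refine Finset.sum_eq_zero fun p _ => ?_
    rw [Fin.prod_univ_castSucc]
    simp [Fin.snocEquiv_apply, hlast, coef]

/-! ### Values of the Q-functions -/

/-- The value of the `n`-th member of a supersymmetric function at a point. -/
noncomputable def evalAt {n : ℕ} (x : Fin n → ℂ) : Gam →+* ℂ :=
  (MvPolynomial.eval x).comp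
    ((Pi.evalRingHom (fun n : ℕ => MvPolynomial (Fin n) ℂ) n).comp Gam.val.toRingHom)

theorem evalAt_multQ (a : ℕ → ℂ) (ha : a 1 = 0) (lam : StrictPartition) {n : ℕ} (x : Fin n → ℂ)
    (hx : Function.Injective x) :
    evalAt x (multQ a ha lam) = 2 ^ lam.length * multPExpr a lam x := by
  rw [multQ, map_mul, map_pow, map_ofNat, ← aeval_multPPoly a lam x hx]
  rfl

/-- This is the tuple formula for `N = 2`. The additional variable makes it uniform in `l`: the
partition has length `2` for `l > 0` and length `1` for `l = 0`. -/
theorem evalAt_multQ₂ (a : ℕ → ℂ) (ha : a 1 = 0) {k l : ℕ} (h : l < k) {n : ℕ} (x : Fin n → ℂ)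
    (hx : Function.Injective x) (hx0 : ∀ i j, x i + x j ≠ 0) :
    evalAt x (multQ₂ a ha k l) =
      ∑ p, ∑ q, coef a x k p * coef a x l q * kernel (extVar x p) (extVar x q) := by
  have h0 : (StrictPartition.ofPair k l h).part 0 = k := by
    by_cases hl : l = 0 <;> simp [StrictPartition.part, StrictPartition.ofPair, hl]
  have h1 : (StrictPartition.ofPair k l h).part 1 = l := by
    by_cases hl : l = 0 <;> simp [StrictPartition.part, StrictPartition.ofPair, hl]
  have hlen : 2 = (StrictPartition.ofPair k l h).length ∨
      2 = (StrictPartition.ofPair k l h).length + 1 := by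
    by_cases hl : l = 0 <;> simp [StrictPartition.length, StrictPartition.ofPair, hl]
  rw [multQ₂, dif_pos h, evalAt_multQ a ha _ x hx,
    two_pow_mul_multPExpr_eq_sum_of_even a _ x hx hx0 hlen even_two,
    ← (finTwoArrowEquiv _).symm.sum_comp, Fintype.sum_prod_type]
  refine Finset.sum_congr rfl fun p _ => Finset.sum_congr rfl fun q _ => ?_
  rw [prod_univ_Ioi_succ]
  simp [h0, h1]

/-- The excluded points are the zeros of the non-zero polynomial `D`, so `D * (f_n - g_n)` vanishes
everywhere, and polynomials over `ℂ` form a domain. -/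
theorem Gam_ext {f g : Gam} (h : ∀ (n : ℕ) (x : Fin n → ℂ), Function.Injective x →
    (∀ i j, x i + x j ≠ 0) → evalAt x f = evalAt x g) : f = g := by
  refine Subtype.ext (funext fun n => ?_)
  let D : MvPolynomial (Fin n) ℂ :=
    (Matrix.vandermonde MvPolynomial.X).det * ∏ i, ∏ j, (MvPolynomial.X i + MvPolynomial.X j)
  have hD : D ≠ 0 := by
    refine mul_ne_zero (Matrix.det_vandermonde_ne_zero_iff.2 MvPolynomial.X_injective)
      (Finset.prod_ne_zero_iff.2 fun i _ => Finset.prod_ne_zero_iff.2 fun j _ e => ?_)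
    have := congrArg (MvPolynomial.eval fun _ => (1 : ℂ)) e
    norm_num at this
  refine sub_eq_zero.1 ((mul_eq_zero.1 (?_ : D * (f.1 n - g.1 n) = 0)).resolve_left hD)
  refine MvPolynomial.funext fun x => ?_
  rw [map_mul, map_sub, map_zero, mul_eq_zero, or_iff_not_imp_left, sub_eq_zero]
  intro hx
  have hdet : MvPolynomial.eval x (Matrix.vandermonde MvPolynomial.X).det =
      (Matrix.vandermonde x).det := by
    rw [RingHom.map_det]
    congr 1
    ext i j
    simp [Matrix.vandermonde]
  simp only [D, map_mul, map_prod, map_add, MvPolynomial.eval_X, hdet, mul_ne_zero_iff,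
    Finset.prod_ne_zero_iff, Finset.mem_univ, true_imp_iff] at hx
  exact h n x (Matrix.det_vandermonde_ne_zero_iff.1 hx.1) hx.2

theorem StrictPartition.part_lt (lam : StrictPartition) {i j : ℕ} (hij : i < j)
    (hi : i < lam.length) : lam.part j < lam.part i := by
  by_cases hj : j < lam.length
  · rw [StrictPartition.part, StrictPartition.part, List.getD_eq_getElem _ _ hi,
      List.getD_eq_getElem _ _ hj]
    exact List.pairwise_iff_getElem.1 lam.strict i j hi hj hij
  · rw [StrictPartition.part, List.getD_eq_default _ _ (not_lt.1 hj)]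
    exact lam.part_pos i hi

end SchurQ

/-! ### The Pfaffian formula -/

theorem mainTheorem3 (a : ℕ → ℂ) (ha : a 1 = 0) (lam : SchurQ.StrictPartition) :
    SchurQ.multQ a ha lam =
      SchurQ.pfaffian (m := (lam.length + 1) / 2)
        (Matrix.of fun i j => SchurQ.multQ₂ a ha (lam.part i) (lam.part j)) := by
  refine SchurQ.Gam_ext fun n x hx hx0 => ?_
  set m := (lam.length + 1) / 2 with hm
  have hentry : SchurQ.pfaffian (m := m) ((Matrix.of fun i j : Fin (2 * m) =>
        SchurQ.multQ₂ a ha (lam.part i) (lam.part j)).map (SchurQ.evalAt x)) =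
      SchurQ.pfaffian (m := m) (Matrix.of fun i j : Fin (2 * m) => ∑ p, ∑ q,
        SchurQ.coef a x (lam.part i) p * SchurQ.coef a x (lam.part j) q *
          SchurQ.kernel (SchurQ.extVar x p) (SchurQ.extVar x q)) := by
    refine SchurQ.pfaffian_congr fun i j hij => ?_
    have hij' : i.val < j.val := hij
    -- Since `i < j < 2m ≤ ℓ + 1`, the index `i` is below `ℓ`, so the parts decrease strictly even
    -- when `λ_j` is the added zero.
    exact SchurQ.evalAt_multQ₂ a ha (lam.part_lt hij' (by omega)) x hx hx0
  rw [SchurQ.map_pfaffian, hentry,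
    SchurQ.pfaffian_sum (fun (i : Fin (2 * m)) p => SchurQ.coef a x (lam.part i) p)
      fun p q => SchurQ.kernel (SchurQ.extVar x p) (SchurQ.extVar x q),
    SchurQ.evalAt_multQ a ha lam x hx,
    SchurQ.two_pow_mul_multPExpr_eq_sum_of_even a lam x hx hx0 (N := 2 * m) (by omega)
      (even_two_mul m)]
  refine Finset.sum_congr rfl fun r _ => ?_
  -- Schur's Pfaffian needs `y_i + y_j ≠ 0` for `i ≠ j`, which fails if the zero variable is chosen
  -- twice. A non-zero coefficient allows `none` only at indices `≥ ℓ`, and there is at most one of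
  -- these below `2m`.
  by_cases hr : ∏ i : Fin (2 * m), SchurQ.coef a x (lam.part i) (r i) = 0
  · rw [hr, zero_mul, zero_mul]
  rw [SchurQ.pfaffian_kernel fun i => SchurQ.extVar x (r i)]
  intro i j hij
  have hne : ∀ p, x p ≠ 0 := fun p h => hx0 p p (by rw [h, add_zero])
  have hnone : ∀ i : Fin (2 * m), r i = none → lam.length ≤ i := by
    intro i hi
    by_contra hlt
    refine Finset.prod_ne_zero_iff.1 hr i (Finset.mem_univ i) ?_
    rw [hi, SchurQ.coef, if_neg (lam.part_pos i (not_le.1 hlt)).ne']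
    rfl
  have hval : i.val ≠ j.val := fun e => hij (Fin.ext e)
  cases hri : r i with
  | none =>
    cases hrj : r j with
    | none =>
      have := hnone i hri
      have := hnone j hrj
      omega
    | some q => simpa [SchurQ.extVar] using hne q
  | some p =>
    cases hrj : r j with
    | none => simpa [SchurQ.extVar] using hne p
    | some q => simpa [SchurQ.extVar] using hx0 p q
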